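/- Let $H$ be a finite simple connected graph with at least one edge and no leaves (no vertex of degree $1$), with $t$ vertices and $k$ edges. Then there is a constant $K$, depending only on $H$, such that the following holds. Direct every edge $e$ of $H$ arbitrarily, with tail half-edge $e^-$ and head half-edge $e^+$; write $a_h$ for the vertex to which a half-edge $h$ is incident, and choose at every vertex of $H$ one distinguished incident half-edge. Let $G$ be a finite simple graph of maximum degree $\Delta$, let $\vec G$ be obtained by replacing every edge of $G$ by its two directed versions, and let $m$ be the number of edges of $\vec G$. Let $\mathcal G$ be a group of $d\times d$ diagonal complex matrices that is either the group of $r$-th roots of unity for some $r\ge 2$ (with $d=1$) or the group $\{\pm I,\pm M,\dots,\pm M^{d-1}\}$ with $d\ge 2$, $M=\mathrm{diag}(1,\omega,\dots,\omega^{d-1})$, $\omega=e^{2\pi i/d}$. Let $\alpha>0$, and let $C\ge t$ be an integer with $$\Delta\le m^{1/2-\alpha},\qquad C\le\min(m^{2\alpha},m^{1/3}).$$ Choose a coloring $\mathcal C:V(G)\to\{1,\dots,C\}$ uniformly at random from a $4k$-wise independent finite family of hash functions and, for every half-edge $h$ of $H$ that is not distinguished, a function $\mathcal X_h:V(G)\to\mathcal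 G$ uniformly at random from a $4k$-wise independent finite family, all choices being independent. (A family is $4k$-wise independent if the values of a random member at any at most $4k$ distinct points are independent and uniform.) For the distinguished half-edge $h$ at a vertex $b$ put $\mathcal X_h(v)=\prod_{j\ne h,\,a_j=b}\mathcal X_j(v)^{-1}$. Define $$\mathcal Z_e^{c,c'}=\sum_{\overrightarrow{vw}\in E(\vec G),\ \mathcal C(v)=c,\ \mathcal C(w)=c'}\mathcal X_{e^-}(v)\,\mathcal X_{e^+}(w),\qquad \mathcal S=\sum_{(c_b)_{b\in V(H)}\ \text{distinct}}\ \prod_{e\in E(H)}\mathcal Z_e^{\,c_{a_{e^-}},\,c_{a_{e^+}}},$$ $$Y=\frac{C^t}{C(C-1)\cdots(C-t+1)}\cdot\frac{\mathrm{tr}(\mathcal S)}{d\cdot\mathrm{auto}(H)},$$ where $\mathrm{auto}(H)$ is the number of automorphisms of $H$. Let $\#H$ be the number of subgraphs of $G$ isomorphic to $H$. Then the estimate $Y$ of $\#H$ has variance $$E\,|Y-E(Y)|^2\ \le\ K\left((\#H)^2+\frac{m^k}{d\,C^{2k-t}}\right).$$ -/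

import Mathlib

open scoped BigOperators

noncomputable section

namespace SubgraphCount

universe u v

/-- A family `h i : V → Y`, `i : ι`, of hash functions is `N`-wise independent if, for a uniformly
random index `i`, the values of `h i` at any at most `N` distinct points are independent and
uniformly distributed in `Y`. -/
def KWiseIndependent {ι V Y : Type*} (N : ℕ) (h : ι → V → Y) : Prop :=
  ∀ s : Finset V, s.card ≤ N → ∀ y : V → Y,
    Nat.card {i : ι // ∀ x ∈ s, h i x = y x} * Nat.card Y ^ s.card = Nat.card ι

/-- The variance `E |f - E f| ^ 2` of a complex-valued function of a uniformly random element of a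
finite sample space. -/
def complexVariance {Ω : Type*} [Fintype Ω] (f : Ω → ℂ) : ℝ :=
  𝔼 ω, ‖f ω - 𝔼 ω', f ω'‖ ^ 2

/-! ### The groups of diagonal matrices

A `d × d` diagonal matrix is given by its diagonal, a function on `Fin d`. Sums, products and
inverses of diagonal matrices are the pointwise ones, and `Matrix.diagonal` recovers the matrix.
A group of diagonal matrices is a subgroup of `Fin d → ℂˣ`. -/

/-- The `1 × 1` matrices whose entry is an `r`-th root of unity. -/
def rootsGroup (r : ℕ) : Subgroup (Fin 1 → ℂˣ) :=
  Subgroup.pi Set.univ fun _ => rootsOfUnity r ℂ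

/-- `ω = exp (2 π i / d)`. -/
def omega (d : ℕ) : ℂˣ :=
  Units.mk0 (Complex.exp (2 * Real.pi * Complex.I / d)) (Complex.exp_ne_zero _)

/-- The group `{±I, ±M, …, ±M ^ (d - 1)}` generated by `M = diag (1, ω, …, ω ^ (d - 1))`
and `-I`. -/
def signedPowersGroup (d : ℕ) : Subgroup (Fin d → ℂˣ) :=
  Subgroup.closure {(fun j : Fin d => omega d ^ (j : ℕ)), -1}

/-- `𝒢` is one of the two kinds of groups of `d × d` diagonal matrices. -/
inductive IsHashGroup : (d : ℕ) → Subgroup (Fin d → ℂˣ) → Prop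
  | roots (r : ℕ) (hr : 2 ≤ r) : IsHashGroup 1 (rootsGroup r)
  | signedPowers (d : ℕ) (hd : 2 ≤ d) : IsHashGroup d (signedPowersGroup d)

/-- The diagonal, with complex entries, of an element of a group of diagonal matrices. -/
def diagEntries {d : ℕ} {𝒢 : Subgroup (Fin d → ℂˣ)} (g : 𝒢) : Fin d → ℂ :=
  fun j => ((g : Fin d → ℂˣ) j : ℂ)

/-! ### The directed small graph and its half-edges -/

/-- A half-edge of the directed version of `H`: the half at the tail of the edge `e` is
`(e, false)`, and the half at its head is `(e, true)`. -/
abbrev HalfEdge {W : Type u} (H : SimpleGraph W) : Type u := H.edgeSet × Bool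

/-- A choice of a direction for every edge of `H`, and of a distinguished incident half-edge at
every vertex of `H`. -/
structure Directing {W : Type u} (H : SimpleGraph W) where
  /-- the vertex to which a half-edge is incident -/
  vert : HalfEdge H → W
  /-- the two halves of an edge are incident to the two ends of this edge -/
  vert_edge : ∀ e : H.edgeSet, s(vert (e, false), vert (e, true)) = (e : Sym2 W)
  /-- the distinguished half-edge at a vertex -/
  dist : W → HalfEdge H
  vert_dist : ∀ b, vert (dist b) = b

namespace Directing

variable {W : Type u} {H : SimpleGraph W} (D : Directing H)

/-- The half-edge `h` is distinguished (at the vertex to which it is incident). -/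
def Distinguished (h : HalfEdge H) : Prop := h = D.dist (D.vert h)

/-- The half-edges that are not distinguished. -/
abbrev FreeHalfEdge : Type u := {h : HalfEdge H // ¬ D.Distinguished h}

end Directing

section Estimate

variable {W : Type u} [Fintype W] [DecidableEq W] {H : SimpleGraph W} [DecidableRel H.Adj]
  (D : Directing H)
  {V : Type v} [Fintype V] [DecidableEq V] (G : SimpleGraph V) [DecidableRel G.Adj]
  {C d : ℕ} {𝒢 : Subgroup (Fin d → ℂˣ)}

open Classical in
/-- All the hash functions `𝒳 h : V → 𝒢`, from those of the half-edges that are not distinguished: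
at a distinguished half-edge `h` at `b`, the value at `z` is the product of the inverses of the
values at `z` of the hash functions of the other half-edges at `b`. -/
def allHashes (X : D.FreeHalfEdge → V → 𝒢) (h : HalfEdge H) (z : V) : 𝒢 :=
  if hd : D.Distinguished h then
    ∏ j : D.FreeHalfEdge with D.vert j.1 = D.vert h, (X j z)⁻¹
  else X ⟨h, hd⟩ z

/-- `ℳ e (y z) = 𝒳 (e, false) y * 𝒳 (e, true) z`, for an edge `e` of `H` and a directed edge
`a = (y, z)` of `G`. -/
def edgeHash (X : D.FreeHalfEdge → V → 𝒢) (e : H.edgeSet) (a : G.Dart) : 𝒢 :=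
  allHashes D X (e, false) a.fst * allHashes D X (e, true) a.snd

/-- `𝒵 e c₁ c₂`, the sum of `ℳ e` over all directed edges of `G` whose tail has color `c₁` and
whose head has color `c₂` (each edge of `G` gives two directed edges). -/
def edgeSum (col : V → Fin C) (X : D.FreeHalfEdge → V → 𝒢) (e : H.edgeSet) (c₁ c₂ : Fin C) :
    Fin d → ℂ :=
  ∑ a : G.Dart with col a.fst = c₁ ∧ col a.snd = c₂, diagEntries (edgeHash D G X e a)

/-- `𝒮 c`, the product over the edges of `H` of the sums `𝒵` for the colors `c` of their ends. -/
def colorProd (col : V → Fin C) (X : D.FreeHalfEdge → V → 𝒢) (c : W → Fin C) : Fin d → ℂ :=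
  ∏ e : H.edgeSet, edgeSum D G col X e (c (D.vert (e, false))) (c (D.vert (e, true)))

open Classical in
/-- `𝒮`, the sum of `𝒮 c` over all tuples `c` of distinct colors. -/
def totalSum (col : V → Fin C) (X : D.FreeHalfEdge → V → 𝒢) : Fin d → ℂ :=
  ∑ c : W → Fin C with Function.Injective c, colorProd D G col X c

/-- The estimate of the number of copies of `H` in `G`, for given colors and hash functions:
`C ^ t / (C (C - 1) ⋯ (C - t + 1)) * tr 𝒮 / (d * auto H)`. -/
def estimate (col : V → Fin C) (X : D.FreeHalfEdge → V → 𝒢) : ℂ :=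
  ((C : ℂ) ^ Fintype.card W / (C.descFactorial (Fintype.card W) : ℂ)) *
    (Matrix.trace (Matrix.diagonal (totalSum D G col X)) / ((d : ℂ) * (Nat.card (H ≃g H) : ℂ)))

open Classical in
/-- The variance of the estimate when the coloring is uniformly random in the family `col`, the hash
function of each half-edge that is not distinguished is uniformly random in the family `x`, and
all these choices are independent. -/
def estimateVariance {I J : Type*} [Fintype I] [Fintype J]
    (col : I → V → Fin C) (x : J → V → 𝒢) : ℝ :=
  complexVariance fun ω : I × (D.FreeHalfEdge → J) =>
    estimate D G (col ω.1) fun h => x (ω.2 h)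

end Estimate

end SubgraphCount

end

/-! The variance is at most the second moment of the estimate, so the mean is never computed.
Expanding the products, the trace of `𝒮` is a sum over a diagonal entry and an assignment `φ` of a
directed edge of `G` to every edge of `H` (`totalSum_apply`). Such a `φ` labels the half-edges of
`H` by vertices of `G`. Its term is the indicator that the colors of the labels fit, times one
factor for each free half-edge: the hash at its own label, times the inverse of the same hash at the
label of the distinguished half-edge at the same vertex of `H`.

In the second moment, the average over a pair of terms splits into one average per free half-edge,
of four nontrivial character values. It vanishes unless the four points coincide in pairs
(`norm_sum_four_le`). Two kinds of pairs survive (`consistent_or_isMixed`).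

Consistent pairs: both labellings are constant at every vertex of `H`. Since the colors are
distinct, both are labelled copies of `H`, which gives the term `(#H)^2`.

Mixed pairs: at each vertex of `H` the two labellings agree, or show the same two labels up to
order, and at some vertex they are not constant with different values. The characters must then be
equal or inverse, which leaves at most `2 * d` of the `d ^ 2` pairs of entries; this is the source
of the factor `1 / d`. Fix the pattern of coincidences of labels, with `n` labels, `p` components of
the graph they form, and `g` vertices of `H` where the labellings split. There are at most `(m^n
C^(2p-n))^(1/2)` such pairs (`card_hom_sq_mul_le`), and their colors fit with probability at most
`C^(t+g-n)` (`card_monochromatic_le`). The combinatorial core is `p + g ≤ k`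
(`Directing.card_classes_le`), which rests on connectedness and the absence of leaves. Together with
`n ≤ 2k` and `C^3 ≤ m` it gives `m^k / C^(2k-t)`. -/

open scoped BigOperators

namespace SubgraphCount

universe u v

/-! ### Averages over independent hash families -/

/-- The average of a function of the values of a random member of an independent family at few
points is the average of this function over all tuples of values. -/
theorem KWiseIndependent.sum_mul_card {ι V Y R : Type*} [CommSemiring R] [Fintype ι]
    [Finite Y] [Nonempty Y] {N : ℕ} {h : ι → V → Y} (hh : KWiseIndependent N h)
    (s : Finset V) (hs : s.card ≤ N) [Fintype (s → Y)] (F : (s → Y) → R) :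
    (∑ i, F fun x => h i x) * (Nat.card Y : R) ^ s.card = Nat.card ι * ∑ y, F y := by
  classical
  have key : ∀ y : s → Y, (Nat.card {i // (fun x : s => h i x) = y} : R) *
      (Nat.card Y : R) ^ s.card = Nat.card ι := by
    intro y
    -- The values of `y'` outside `s` play no role.
    let y' : V → Y := fun v => if hv : v ∈ s then y ⟨v, hv⟩ else Classical.arbitrary Y
    have h1 := hh s hs y'
    have h2 : ∀ i, (∀ x ∈ s, h i x = y' x) ↔ (fun x : s => h i x) = y := by
      intro i
      rw [funext_iff]
      constructor
      · rintro H ⟨x, hx⟩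
        rw [H x hx]
        simp [y', hx]
      · intro H x hx
        rw [H ⟨x, hx⟩]
        simp [y', hx]
    simp only [h2] at h1
    exact_mod_cast congrArg (Nat.cast : ℕ → R) h1
  calc _ = (∑ y : s → Y, (Nat.card {i // (fun x : s => h i x) = y} : R) * F y) *
        (Nat.card Y : R) ^ s.card := by
        congr 1
        rw [← Finset.sum_fiberwise (g := fun i => (fun x : s => h i x))]
        refine Finset.sum_congr rfl fun y _ => ?_
        rw [Finset.sum_congr rfl fun i hi => congrArg F (Finset.mem_filter.1 hi).2,
          Finset.sum_const, Nat.card_eq_fintype_card, Fintype.card_subtype, nsmul_eq_mul]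
    _ = _ := by
        rw [Finset.sum_mul, Finset.mul_sum]
        refine Finset.sum_congr rfl fun y _ => ?_
        rw [mul_right_comm, key]

/-- For infinite `Y`, `Nat.card Y = 0`, and independence at a single point would make `ι` empty.
This is where the finiteness of `𝒢` comes from, hence that its characters have absolute value one.
-/
theorem KWiseIndependent.finite {ι V Y : Type*} [Finite ι] [Nonempty ι] [Nonempty V] {N : ℕ}
    (hN : 1 ≤ N) {h : ι → V → Y} (hh : KWiseIndependent N h) : Finite Y := by
  obtain ⟨v⟩ := ‹Nonempty V›
  have := hh {v} (by simpa using hN) (h (Classical.arbitrary ι))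
  rw [Finset.card_singleton, pow_one] at this
  have h0 : Nat.card Y ≠ 0 := by
    intro h0
    rw [h0, mul_zero] at this
    exact Nat.card_pos.ne this
  exact Nat.finite_of_card_ne_zero h0

/-- The average of a product of characters at points `π l` vanishes, unless at each point the
product of the characters is trivial. -/
theorem KWiseIndependent.sum_prod_char_eq_zero {ι V A L : Type*} [Fintype ι] [CommGroup A]
    [Finite A] [Fintype L] [DecidableEq V] {N : ℕ} {h : ι → V → A} (hh : KWiseIndependent N h)
    (hL : Fintype.card L ≤ N) (π : L → V) (θ : L → A →* ℂˣ) {v : V}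
    (hv : ∏ l with π l = v, θ l ≠ 1) : ∑ i, ∏ l, (θ l (h i (π l)) : ℂ) = 0 := by
  classical
  have := Fintype.ofFinite A
  set s : Finset V := Finset.univ.image π with hs
  have hsN : s.card ≤ N := (Finset.card_image_le).trans (by simpa using hL)
  have hvs : v ∈ s := by
    by_contra hvs
    refine hv ?_
    rw [Finset.filter_false_of_mem, Finset.prod_empty]
    intro l _ hl
    exact hvs (Finset.mem_image.2 ⟨l, Finset.mem_univ _, hl⟩)
  have hprod : ∀ i, ∏ l, (θ l (h i (π l)) : ℂ) =
      ∏ x : s, (((∏ l with π l = x, θ l) (h i x) : ℂˣ) : ℂ) := by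
    intro i
    rw [Finset.prod_coe_sort s fun x => (((∏ l with π l = x, θ l) (h i x) : ℂˣ) : ℂ)]
    rw [← Finset.prod_fiberwise_of_maps_to (s := Finset.univ) (t := s) (g := π)
      fun l _ => Finset.mem_image_of_mem _ (Finset.mem_univ l)]
    refine Finset.prod_congr rfl fun x _ => ?_
    rw [MonoidHom.finsetProd_apply, Units.coe_prod]
    refine Finset.prod_congr rfl fun l hl => ?_
    rw [(Finset.mem_filter.1 hl).2]
  have h1 := hh.sum_mul_card s hsN
    fun y => ∏ x : s, (((∏ l with π l = x, θ l) (y x) : ℂˣ) : ℂ)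
  have h2 : ∏ x : s, ∑ g : A, (((∏ l with π l = (x : V), θ l) g : ℂˣ) : ℂ) = 0 := by
    refine Finset.prod_eq_zero (Finset.mem_univ ⟨v, hvs⟩) ?_
    refine sum_hom_units_eq_zero ((Units.coeHom ℂ).comp (∏ l with π l = v, θ l)) fun h1 => hv ?_
    ext g
    exact DFunLike.congr_fun h1 g
  rw [Fintype.prod_sum] at h2
  rw [h2, mul_zero] at h1
  rw [Finset.sum_congr rfl fun i _ => hprod i]
  exact (mul_eq_zero.1 h1).resolve_right (pow_ne_zero _ (by exact_mod_cast Nat.card_pos.ne'))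

/-! ### Pairs of labellings of the half-edges and their coincidences -/

namespace Directing

variable {W : Type u} {H : SimpleGraph W} (D : Directing H)

/-- The other half of the edge of a half-edge. -/
def opp (h : HalfEdge H) : HalfEdge H := (h.1, !h.2)

theorem opp_opp (h : HalfEdge H) : opp (opp h) = h := by simp [opp]

theorem eq_or_eq_opp {h h' : HalfEdge H} (hh : h'.1 = h.1) : h' = h ∨ h' = opp h := by
  obtain ⟨e, i⟩ := h
  obtain ⟨e', i'⟩ := h'
  obtain rfl : e' = e := hh
  cases i <;> cases i' <;> simp [opp]

theorem edge_eq (h : HalfEdge H) : s(D.vert h, D.vert (opp h)) = (h.1 : Sym2 W) := by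
  obtain ⟨e, i⟩ := h
  cases i
  · exact D.vert_edge e
  · exact Sym2.eq_swap.trans (D.vert_edge e)

theorem adj_opp (h : HalfEdge H) : H.Adj (D.vert h) (D.vert (opp h)) := by
  rw [← SimpleGraph.mem_edgeSet, D.edge_eq]
  exact h.1.2

theorem exists_halfEdge_of_adj {b c : W} (hbc : H.Adj b c) :
    ∃ h, D.vert h = b ∧ D.vert (opp h) = c := by
  have h1 := D.vert_edge ⟨s(b, c), hbc⟩
  rcases Sym2.eq_iff.1 h1 with ⟨h2, h3⟩ | ⟨h2, h3⟩
  · exact ⟨(⟨s(b, c), hbc⟩, false), h2, h3⟩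
  · exact ⟨(⟨s(b, c), hbc⟩, true), h3, h2⟩

theorem exists_other_halfEdge [Fintype W] [DecidableRel H.Adj] (hleaf : ∀ b, H.degree b ≠ 1)
    (h : HalfEdge H) : ∃ h', D.vert h' = D.vert h ∧ h'.1 ≠ h.1 := by
  have h1 : ∃ c, H.Adj (D.vert h) c ∧ c ≠ D.vert (opp h) := by
    by_contra! hc
    refine hleaf (D.vert h) ?_
    rw [SimpleGraph.degree_eq_one_iff_existsUnique_adj]
    exact ⟨_, D.adj_opp h, hc⟩
  obtain ⟨c, hc, hne⟩ := h1
  obtain ⟨h', h2, h3⟩ := D.exists_halfEdge_of_adj hc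
  refine ⟨h', h2, fun he => hne ?_⟩
  have h4 := D.edge_eq h'
  rw [he, ← D.edge_eq h, h2, h3] at h4
  exact Sym2.congr_right.1 h4

/-- In a connected graph, a property of edges that passes to edges sharing a vertex passes to all
edges. -/
theorem forall_edge_of_connected (hconn : H.Connected) {p : H.edgeSet → Prop}
    (hp : ∀ h h', D.vert h = D.vert h' → p h.1 → p h'.1) {e : H.edgeSet} (he : p e)
    (e' : H.edgeSet) : p e' := by
  have key : ∀ b c, H.Walk b c → (∀ h, D.vert h = b → p h.1) → ∀ h, D.vert h = c → p h.1 := by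
    intro b c w
    induction w with
    | nil => exact id
    | cons hbc _ ih =>
      intro hb
      obtain ⟨h, h1, h2⟩ := D.exists_halfEdge_of_adj hbc
      exact ih fun h' hh' => hp (opp h) h' (h2.trans hh'.symm) (hb h h1)
  obtain ⟨w⟩ := hconn.preconnected (D.vert (e, false)) (D.vert (e', false))
  exact key _ _ w (fun h hh => hp (e, false) h hh.symm he) (e', false) rfl

/-- At `b`, both labellings of the half-edges agree. -/
def ParallelAt {P : Type*} (π : Bool → HalfEdge H → P) (b : W) : Prop :=
  ∀ h, D.vert h = b → π false h = π true h

/-- At `b`, the pair of labels of a half-edge is the same for all half-edges, up to the order. -/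
def SwappedAt {P : Type*} (π : Bool → HalfEdge H → P) (b : W) : Prop :=
  ∀ h h', D.vert h = b → D.vert h' = b →
    ∃ j : Bool, ∀ i, π i h = π (xor i j) h'

/-- At `b`, both labellings of the half-edges are constant, with different values. -/
def SplitAt {P : Type*} (π : Bool → HalfEdge H → P) (b : W) : Prop :=
  (∀ h, D.vert h = b → ∀ i, π i h = π i (D.dist b)) ∧ π false (D.dist b) ≠ π true (D.dist b)

variable {D}

/-- Where the labellings do not split, some label is used by both of them; the color bound and the
class bound both need this. -/
theorem exists_eq_of_not_splitAt {P : Type*} {π : Bool → HalfEdge H → P} {b : W}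
    (hb : D.ParallelAt π b ∨ D.SwappedAt π b) (hs : ¬ D.SplitAt π b) :
    ∃ h h', D.vert h = b ∧ D.vert h' = b ∧ π false h = π true h' := by
  have hd := D.vert_dist b
  rcases hb with hb | hb
  · exact ⟨_, _, hd, hd, hb _ hd⟩
  · by_cases hne : π false (D.dist b) = π true (D.dist b)
    · exact ⟨_, _, hd, hd, hne⟩
    · have : ¬ ∀ h, D.vert h = b → ∀ i, π i h = π i (D.dist b) := fun h => hs ⟨h, hne⟩
      push Not at this
      obtain ⟨h, hh, i, hi⟩ := this
      obtain ⟨j, hj⟩ := hb _ _ hh hd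
      cases j with
      | false => exact absurd (by simpa using hj i) hi
      | true => exact ⟨_, _, hh, hd, by simpa using hj false⟩

variable [Fintype W] [DecidableRel H.Adj]

/-- Every labelled edge shares a label with one outside an injective image of the vertices where
the labelling splits. -/
theorem exists_reps (hconn : H.Connected) (hleaf : ∀ b, H.degree b ≠ 1) {P : Type*}
    {π : Bool → HalfEdge H → P} {r : W} (hr : ¬ D.SplitAt π r) {X : Type*}
    {κ : H.edgeSet → Bool → X}
    (hκ : ∀ h h' i i', π i h = π i' h' → κ h.1 i = κ h'.1 i') :
    ∃ U : Set H.edgeSet, Nat.card U + Nat.card {b // D.SplitAt π b} = Nat.card H.edgeSet ∧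
      ∀ e, ∃ e' ∈ U, ∀ i, κ e i = κ e' i := by
  classical
  -- Each split vertex chooses an edge on a shortest walk to the root `r`, which is itself not
  -- split.
  have hup : ∀ b : {b // D.SplitAt π b}, ∃ h, D.vert h = b ∧
      H.dist (D.vert (opp h)) r < H.dist b r := by
    rintro ⟨b, hb⟩
    obtain ⟨w, hw⟩ := hconn.exists_walk_length_eq_dist b r
    cases w with
    | nil => exact absurd hb hr
    | cons hbc w =>
      obtain ⟨h, h1, h2⟩ := D.exists_halfEdge_of_adj hbc
      refine ⟨h, h1, ?_⟩
      rw [h2, ← hw, SimpleGraph.Walk.length_cons]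
      exact Nat.lt_succ_of_le (SimpleGraph.dist_le w)
  choose up hup1 hup2 using hup
  -- If two split vertices chose the same edge from opposite ends, each would be nearer to `r` than
  -- the other.
  have hinj : Function.Injective fun b => (up b).1 := by
    intro b c hbc
    rcases eq_or_eq_opp hbc with h | h
    · exact Subtype.ext (by rw [← hup1 b, ← hup1 c, h])
    · have h1 := hup2 b
      have h2 := hup2 c
      rw [← h, hup1] at h2
      rw [h, opp_opp, hup1] at h1
      omega
  have := Fintype.ofFinite H.edgeSet
  refine ⟨(Set.range fun b => (up b).1)ᶜ, ?_, ?_⟩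
  · rw [← Set.ncard_add_ncard_compl (Set.range fun b => (up b).1), ← Nat.card_coe_set_eq,
      ← Nat.card_coe_set_eq, add_comm, Nat.card_range_of_injective hinj]
  -- A chosen edge shares its labels with another edge at its split vertex, as there are no leaves.
  -- If that one is chosen too, it is chosen by a vertex farther from `r`, so the replacement ends;
  -- `n` bounds the remaining distance.
  · have key : ∀ n, ∀ b : {b // D.SplitAt π b},
        (Finset.univ.sup fun b => H.dist b r) - H.dist b r < n →
        ∃ e' ∈ (Set.range fun b => (up b).1)ᶜ, ∀ i, κ (up b).1 i = κ e' i := by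
      intro n
      induction n with
      | zero => intro b hb; omega
      | succ n ih =>
        intro b hb
        obtain ⟨h', h1, h2⟩ := D.exists_other_halfEdge hleaf (up b)
        have hκ' : ∀ i, κ (up b).1 i = κ h'.1 i := fun i => hκ _ _ _ _ <| by
          rw [b.2.1 _ (hup1 b) i, b.2.1 _ (h1.trans (hup1 b)) i]
        by_cases hh' : h'.1 ∈ Set.range fun b => (up b).1
        · obtain ⟨c, hc⟩ := hh'
          have hlt : H.dist b r < H.dist c r := by
            have h3 : h' = opp (up c) := by
              refine (eq_or_eq_opp hc.symm).resolve_left ?_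
              rintro rfl
              have : c = b := Subtype.ext (by rw [← hup1 c, h1, hup1])
              exact h2 (by rw [this])
            have h4 := hup2 c
            rwa [← h3, h1, hup1] at h4
          have hle : H.dist c r ≤ Finset.univ.sup fun b => H.dist b r :=
            Finset.le_sup (f := fun b => H.dist b r) (Finset.mem_univ (c : W))
          obtain ⟨e', he', h5⟩ := ih c (by omega)
          exact ⟨e', he', fun i => by rw [hκ', ← h5, ← hc]⟩
        · exact ⟨_, hh', hκ'⟩
    intro e
    by_cases he : e ∈ Set.range fun b => (up b).1
    · obtain ⟨b, rfl⟩ := he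
      exact key _ b (Nat.lt_succ_self _)
    · exact ⟨e, he, fun _ => rfl⟩

/-- If the labelled edges fall into classes, and labelled edges with a common label are in the same
class, then there are at most `k - g` classes, where `k` is the number of edges and `g` is the
number of vertices where the labelling splits, unless the labelling splits everywhere. -/
theorem card_classes_le (hconn : H.Connected) (hleaf : ∀ b, H.degree b ≠ 1) {P : Type*}
    {π : Bool → HalfEdge H → P} (hπ : ∀ b, D.ParallelAt π b ∨ D.SwappedAt π b)
    {r : W} (hr : ¬ D.SplitAt π r) {X : Type*} [Finite X]
    {κ : H.edgeSet → Bool → X} (hsurj : ∀ x, ∃ e i, κ e i = x)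
    (hκ : ∀ h h' i i', π i h = π i' h' → κ h.1 i = κ h'.1 i') :
    Nat.card X + Nat.card {b // D.SplitAt π b} ≤ Nat.card H.edgeSet := by
  classical
  obtain ⟨U, hU, hrep⟩ := exists_reps hconn hleaf hr hκ
  rw [← hU]
  refine Nat.add_le_add_right ?_ _
  by_cases hM : ∃ e, κ e false = κ e true
  -- If both copies of one edge are in the same class, this spreads to all edges, and each edge of
  -- `U` represents a single class.
  · obtain ⟨e, he⟩ := hM
    have hall : ∀ e, κ e false = κ e true := by
      refine D.forall_edge_of_connected hconn ?_ he
      intro h h' hh hM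
      rcases hπ (D.vert h') with hb | hb
      · exact hκ _ _ _ _ (hb h' rfl)
      · obtain ⟨j, hj⟩ := hb h' h rfl hh
        rw [hκ _ _ _ _ (hj false), hκ _ _ _ _ (hj true)]
        cases j
        · exact hM
        · exact hM.symm
    refine Nat.card_le_card_of_surjective (fun u : U => κ u false) fun x => ?_
    obtain ⟨e, i, rfl⟩ := hsurj x
    obtain ⟨e', he', h1⟩ := hrep e
    refine ⟨⟨e', he'⟩, ?_⟩
    cases i
    · exact (h1 false).symm
    · exact (hall e').trans (h1 true).symm
  -- Otherwise no vertex is parallel, so all edges show the same two classes up to order, and it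
  -- remains to see that `U` has at least two elements.
  · push Not at hM
    obtain ⟨h₁, h₂, hv₁, hv₂, h12⟩ := exists_eq_of_not_splitAt (hπ r) hr
    have hX : Nat.card X ≤ 2 := by
      have hp : ∀ e, ∃ j, ∀ i, κ h₁.1 i = κ e (xor i j) := by
        refine D.forall_edge_of_connected hconn ?_ (e := h₁.1) ⟨false, fun i => by simp⟩
        rintro h h' hh ⟨j, hj⟩
        rcases hπ (D.vert h') with hb | hb
        · exact absurd (hκ _ _ _ _ (hb h' rfl)) (hM _)
        · obtain ⟨j', hj'⟩ := hb h h' hh rfl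
          refine ⟨xor j j', fun i => ?_⟩
          rw [hj, hκ _ _ _ _ (hj' _), Bool.xor_assoc]
      have h3 : Function.Surjective fun i => κ h₁.1 i := by
        intro x
        obtain ⟨e, i, rfl⟩ := hsurj x
        obtain ⟨j, hj⟩ := hp e
        exact ⟨xor i j, by simp [hj]⟩
      simpa using Nat.card_le_card_of_surjective _ h3
    refine hX.trans ?_
    -- With a single representative, the label shared by both labellings at `r` would put its two
    -- copies in one class.
    by_contra! hlt
    obtain ⟨e₁, he₁, h1⟩ := hrep h₁.1
    obtain ⟨e₂, he₂, h2⟩ := hrep h₂.1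
    have : Subsingleton U := Finite.card_le_one_iff_subsingleton.1 (by omega)
    obtain rfl : e₁ = e₂ := congrArg Subtype.val (Subsingleton.elim (⟨e₁, he₁⟩ : U) ⟨e₂, he₂⟩)
    refine hM e₁ ?_
    rw [← h1, ← h2]
    exact hκ _ _ _ _ h12

/-- The number of labels is at most the number of half-edges. -/
theorem card_labels_le (hleaf : ∀ b, H.degree b ≠ 1) {P : Type*}
    {π : Bool → HalfEdge H → P} (hπ : ∀ b, D.ParallelAt π b ∨ D.SwappedAt π b)
    (hsurj : ∀ x, ∃ i h, π i h = x) : Nat.card P ≤ Nat.card H.edgeSet * 2 := by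
  classical
  -- A vertex that is not parallel shows at most two labels and has at least two half-edges: the
  -- distinguished one takes the first label, all others take the second.
  have h1 : Function.Surjective fun h : HalfEdge H =>
      if D.ParallelAt π (D.vert h) then π false h else
        if h = D.dist (D.vert h) then π false h else π true (D.dist (D.vert h)) := by
    intro x
    obtain ⟨i, h, rfl⟩ := hsurj x
    by_cases hp : D.ParallelAt π (D.vert h)
    · refine ⟨h, ?_⟩
      simp only [hp, if_true]
      cases i
      · rfl
      · exact hp h rfl
    · set d := D.dist (D.vert h) with hd
      have hdv : D.vert d = D.vert h := D.vert_dist _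
      obtain ⟨j, hj⟩ := (hπ (D.vert h)).resolve_left hp h d rfl hdv
      cases hij : xor i j with
      | false =>
        refine ⟨d, ?_⟩
        rw [hj, hij]
        simp only [hdv, hp, if_false, ← hd, if_true]
      | true =>
        obtain ⟨h', h2, h3⟩ := D.exists_other_halfEdge hleaf d
        have h4 : h' ≠ d := fun h => h3 (by rw [h])
        refine ⟨h', ?_⟩
        rw [hj, hij]
        simp only [h2, hdv, hp, if_false, ← hd, h4]
  have h2 := Nat.card_le_card_of_surjective _ h1
  rwa [Nat.card_prod, Nat.card_eq_fintype_card (α := Bool), Fintype.card_bool] at h2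

end Directing

/-! ### Homomorphism counts and the balance of exponents -/

/-- Vertices are removed one at a time, keeping the graph connected. The last two span an edge,
which has as many images as there are darts; each restored vertex has a placed neighbor, hence at
most `G.maxDegree` images. -/
theorem card_hom_le_of_connected {V : Type v} [Fintype V] (G : SimpleGraph V)
    [DecidableRel G.Adj] (n : ℕ) : ∀ (P : Type u) [Finite P] (Q : SimpleGraph P), Q.Connected →
      Nat.card P = n + 2 → Nat.card (Q →g G) ≤ Fintype.card G.Dart * G.maxDegree ^ n := by
  induction n with
  | zero =>
    intro P _ Q hQ hP
    have : Nontrivial P := by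
      rw [← Finite.one_lt_card_iff_nontrivial]; omega
    obtain ⟨a⟩ := hQ.nonempty
    obtain ⟨b, hab⟩ := hQ.preconnected.exists_adj_of_nontrivial a
    have huniv : ∀ x, x = a ∨ x = b := by
      intro x
      by_contra! hx
      have h3 : ({a, b, x} : Set P).ncard = 3 :=
        Set.ncard_eq_three.2 ⟨a, b, x, hab.ne, hx.1.symm, hx.2.symm, rfl⟩
      have := Set.ncard_le_card ({a, b, x} : Set P)
      omega
    rw [pow_zero, mul_one, ← Nat.card_eq_fintype_card]
    refine Nat.card_le_card_of_injective
      (fun f : Q →g G => (⟨(f a, f b), f.map_adj hab⟩ : G.Dart)) ?_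
    intro f g hfg
    simp only [SimpleGraph.Dart.mk.injEq, Prod.mk.injEq] at hfg
    ext x
    rcases huniv x with rfl | rfl
    · exact hfg.1
    · exact hfg.2
  | succ n ih =>
    intro P _ Q hQ hP
    have : Nontrivial P := by
      rw [← Finite.one_lt_card_iff_nontrivial]; omega
    obtain ⟨z, hz⟩ := hQ.exists_connected_induce_compl_singleton_of_finite_nontrivial
    obtain ⟨w, hzw⟩ := hQ.preconnected.exists_adj_of_nontrivial z
    have hw : w ∈ ({z}ᶜ : Set P) := hzw.ne'
    have hcard : Nat.card ({z}ᶜ : Set P) = n + 2 := by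
      have := Set.ncard_add_ncard_compl ({z} : Set P)
      rw [Set.ncard_singleton, ← Nat.card_coe_set_eq ({z}ᶜ : Set P)] at this
      omega
    have h1 := ih _ (Q.induce {z}ᶜ) hz hcard
    let F : (Q →g G) → Σ f : Q.induce {z}ᶜ →g G, G.neighborSet (f ⟨w, hw⟩) := fun f =>
      ⟨f.comp (SimpleGraph.Embedding.induce _).toHom, ⟨f z, f.map_adj hzw.symm⟩⟩
    have hF : Function.Injective F := by
      intro f g hfg
      have h2 : f.comp (SimpleGraph.Embedding.induce ({z}ᶜ : Set P)).toHom =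
          g.comp (SimpleGraph.Embedding.induce ({z}ᶜ : Set P)).toHom := congrArg Sigma.fst hfg
      have h3 : f z = g z := congrArg (fun s : (Σ f : Q.induce {z}ᶜ →g G,
        G.neighborSet (f ⟨w, hw⟩)) => (s.2 : V)) hfg
      ext x
      by_cases hx : x = z
      · rw [hx, h3]
      · exact DFunLike.congr_fun h2 (⟨x, hx⟩ : ({z}ᶜ : Set P))
    have : Finite (Q.induce {z}ᶜ →g G) := DFunLike.finite _
    have := Fintype.ofFinite (Q.induce {z}ᶜ →g G)
    refine (Nat.card_le_card_of_injective F hF).trans ?_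
    rw [Nat.card_sigma, pow_succ, ← mul_assoc]
    calc _ ≤ ∑ f : Q.induce {z}ᶜ →g G, G.maxDegree := by
          refine Finset.sum_le_sum fun f _ => ?_
          rw [Nat.card_eq_fintype_card, SimpleGraph.card_neighborSet_eq_degree]
          exact G.degree_le_maxDegree _
      _ = Nat.card (Q.induce {z}ᶜ →g G) * G.maxDegree := by
          rw [Finset.sum_const, smul_eq_mul, Nat.card_eq_fintype_card, Finset.card_univ]
      _ ≤ _ := Nat.mul_le_mul_right _ h1

/-- If `C * Δ ^ 2 ≤ m`, then a graph without isolated vertices on `n` vertices with `p` connected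
components has at most `(m ^ n * C ^ (2 * p - n)) ^ (1 / 2)` homomorphisms to `G`. -/
theorem card_hom_sq_mul_le {V : Type v} [Fintype V] (G : SimpleGraph V)
    [DecidableRel G.Adj] {C : ℕ} (hC : C * G.maxDegree ^ 2 ≤ Fintype.card G.Dart)
    {P : Type u} [Finite P] (Q : SimpleGraph P) (hQ : ∀ x, ∃ y, Q.Adj x y) :
    Nat.card (Q →g G) ^ 2 * C ^ Nat.card P ≤
      Fintype.card G.Dart ^ Nat.card P * C ^ (2 * Nat.card Q.ConnectedComponent) := by
  classical
  have := Fintype.ofFinite P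
  have := Fintype.ofFinite Q.ConnectedComponent
  have hfin : ∀ c : Q.ConnectedComponent, Finite (c.toSimpleGraph →g G) := fun c =>
    DFunLike.finite _
  have hle : Nat.card (Q →g G) ≤ ∏ c : Q.ConnectedComponent, Nat.card (c.toSimpleGraph →g G) := by
    rw [← Nat.card_pi]
    refine Nat.card_le_card_of_injective
      (fun (f : Q →g G) (c : Q.ConnectedComponent) => f.comp c.toSimpleGraph_hom) ?_
    intro f g hfg
    ext x
    exact DFunLike.congr_fun (congrFun hfg (Q.connectedComponentMk x)) ⟨x, rfl⟩
  have hsum : Nat.card P = ∑ c : Q.ConnectedComponent, Nat.card c := by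
    rw [← Nat.card_sigma]
    exact Nat.card_congr (Equiv.sigmaFiberEquiv Q.connectedComponentMk).symm
  have hc : ∀ c : Q.ConnectedComponent, Nat.card (c.toSimpleGraph →g G) ^ 2 * C ^ Nat.card c ≤
      Fintype.card G.Dart ^ Nat.card c * C ^ 2 := by
    intro c
    have h2 : 2 ≤ Nat.card c := by
      obtain ⟨x, hx⟩ := c.nonempty_supp
      obtain ⟨y, hxy⟩ := hQ x
      have : Nontrivial c :=
        ⟨⟨x, hx⟩, ⟨y, c.mem_supp_of_adj_mem_supp hx hxy⟩, fun h => hxy.ne (congrArg Subtype.val h)⟩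
      exact Finite.one_lt_card_iff_nontrivial.2 this
    obtain ⟨n, hn⟩ := Nat.exists_eq_add_of_le' h2
    have h3 := card_hom_le_of_connected G n c c.toSimpleGraph c.connected_toSimpleGraph hn
    rw [hn]
    calc _ ≤ (Fintype.card G.Dart * G.maxDegree ^ n) ^ 2 * C ^ (n + 2) := by gcongr
      _ = Fintype.card G.Dart ^ 2 * (C * G.maxDegree ^ 2) ^ n * C ^ 2 := by ring
      _ ≤ Fintype.card G.Dart ^ 2 * Fintype.card G.Dart ^ n * C ^ 2 := by gcongr
      _ = _ := by ring
  calc _ ≤ (∏ c : Q.ConnectedComponent, Nat.card (c.toSimpleGraph →g G)) ^ 2 *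
        C ^ Nat.card P := by gcongr
    _ = ∏ c : Q.ConnectedComponent, Nat.card (c.toSimpleGraph →g G) ^ 2 * C ^ Nat.card c := by
        rw [Finset.prod_mul_distrib, Finset.prod_pow, Finset.prod_pow_eq_pow_sum, hsum]
    _ ≤ ∏ c : Q.ConnectedComponent, Fintype.card G.Dart ^ Nat.card c * C ^ 2 :=
        Finset.prod_le_prod' fun c _ => hc c
    _ = _ := by
        rw [Finset.prod_mul_distrib, Finset.prod_pow_eq_pow_sum, ← hsum, Finset.prod_const,
          ← pow_mul, Finset.card_univ, Nat.card_eq_fintype_card (α := Q.ConnectedComponent)]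

/-- The bounds for the number of pairs and for the coloring probability give `(m / C^3)^(n/2) *
C^(p+g+t)`. Here `p + g ≤ k`, and `n` may be raised to `2k` because `C^3 ≤ m`. Squaring avoids
half-integral exponents. -/
theorem mul_pow_sub_le {S N I C m n k t g p : ℕ} (hC : 0 < C) (hm : C ^ 3 ≤ m)
    (hn : n ≤ k * 2) (ht : t ≤ 2 * k) (hp : p + g ≤ k)
    (hN : N ^ 2 * C ^ n ≤ m ^ n * C ^ (2 * p)) (hS : S * C ^ n ≤ N * (I * C ^ (t + g))) :
    S * C ^ (2 * k - t) ≤ m ^ k * I := by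
  obtain ⟨a, ha⟩ := Nat.exists_eq_add_of_le hn
  obtain ⟨b, hb⟩ := Nat.exists_eq_add_of_le ht
  rw [hb, Nat.add_sub_cancel_left]
  refine (pow_le_pow_iff_left₀ (Nat.zero_le _) (Nat.zero_le _) two_ne_zero).1 ?_
  refine Nat.le_of_mul_le_mul_right (c := C ^ (2 * k + 2 * t)) ?_ (by positivity)
  calc (S * C ^ b) ^ 2 * C ^ (2 * k + 2 * t) = S ^ 2 * C ^ (2 * b + (2 * k + 2 * t)) := by ring
    -- Both exponents are `6k`, since `n + a = t + b = 2k`.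
    _ = S ^ 2 * C ^ (2 * n + n + 3 * a) := by congr 2; omega
    _ = (S * C ^ n) ^ 2 * C ^ n * (C ^ 3) ^ a := by ring
    _ ≤ (N * (I * C ^ (t + g))) ^ 2 * C ^ n * m ^ a := by gcongr
    _ = (N ^ 2 * C ^ n) * (I ^ 2 * C ^ (2 * t + 2 * g) * m ^ a) := by ring
    _ ≤ (m ^ n * C ^ (2 * p)) * (I ^ 2 * C ^ (2 * t + 2 * g) * m ^ a) := by gcongr
    _ = m ^ (n + a) * I ^ 2 * C ^ (2 * (p + g) + 2 * t) := by ring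
    _ ≤ m ^ (n + a) * I ^ 2 * C ^ (2 * k + 2 * t) := by gcongr
    _ = (m ^ k * I) ^ 2 * C ^ (2 * k + 2 * t) := by rw [← ha]; ring

/-! ### Contribution of the mixed pairs -/

namespace Directing

variable {W : Type u} {H : SimpleGraph W} {D : Directing H} {V : Type v}

theorem parallelAt_comp_iff {P : Type*} {l : Bool → HalfEdge H → P} {f : P → V}
    (hf : Function.Injective f) {b : W} :
    D.ParallelAt (fun i h => f (l i h)) b ↔ D.ParallelAt l b := by
  simp only [ParallelAt, hf.eq_iff]

theorem swappedAt_comp_iff {P : Type*} {l : Bool → HalfEdge H → P} {f : P → V}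
    (hf : Function.Injective f) {b : W} :
    D.SwappedAt (fun i h => f (l i h)) b ↔ D.SwappedAt l b := by
  simp only [SwappedAt, hf.eq_iff]

theorem splitAt_comp_iff {P : Type*} {l : Bool → HalfEdge H → P} {f : P → V}
    (hf : Function.Injective f) {b : W} :
    D.SplitAt (fun i h => f (l i h)) b ↔ D.SplitAt l b := by
  simp only [SplitAt, hf.eq_iff, ne_eq]

variable (D)

/-- In the coloring `col`, labels at the same vertex have the same color. -/
def Monochromatic {P : Type*} {C : ℕ} (π : Bool → HalfEdge H → P) (col : P → Fin C) : Prop :=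
  ∀ i h h', D.vert h = D.vert h' → col (π i h) = col (π i h')

/-- The pairs of labellings of half-edges by vertices of `G` that contribute to the variance without
coming from two copies of `H` in `G`. -/
structure IsMixed (G : SimpleGraph V) (π : Bool → HalfEdge H → V) : Prop where
  adj : ∀ i e, G.Adj (π i (e, false)) (π i (e, true))
  matched : ∀ b, D.ParallelAt π b ∨ D.SwappedAt π b
  not_split : ∃ r, ¬ D.SplitAt π r

variable {D}

/-- A fitting coloring is determined by one color per vertex of `H` and a second one at each split
vertex: elsewhere a common label forces the two colors to agree. -/
theorem card_monochromatic_le [Fintype W] {P : Type*} [Finite P]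
    {l : Bool → HalfEdge H → P}
    (hl : ∀ b, D.ParallelAt l b ∨ D.SwappedAt l b) (hsurj : ∀ x, ∃ i h, l i h = x)
    {f : P → V} (hf : Function.Injective f) {C : ℕ} (hC : 0 < C) {I : Type*} [Fintype I]
    {N : ℕ} {col : I → V → Fin C} (hcol : KWiseIndependent N col) (hN : Nat.card P ≤ N) :
    Nat.card {i // D.Monochromatic (fun j h => f (l j h)) (col i)} * C ^ Nat.card P ≤
      Nat.card I * C ^ (Fintype.card W + Nat.card {b // D.SplitAt l b}) := by
  classical
  have := Fintype.ofFinite P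
  have : Nonempty (Fin C) := ⟨⟨0, hC⟩⟩
  set s : Finset V := Finset.univ.image f with hs
  have hscard : s.card = Nat.card P := by
    rw [Finset.card_image_of_injective _ hf, Finset.card_univ, Nat.card_eq_fintype_card]
  have hmem : ∀ x, f x ∈ s := fun x => Finset.mem_image_of_mem _ (Finset.mem_univ x)
  let l' : Bool → HalfEdge H → s := fun j h => ⟨f (l j h), hmem _⟩
  have h1 := hcol.sum_mul_card (R := ℕ) s (hscard.trans_le hN)
    fun y => if D.Monochromatic l' y then 1 else 0
  rw [Finset.sum_boole, Finset.sum_boole, hscard, Nat.card_eq_fintype_card (α := Fin C),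
    Fintype.card_fin, ← Fintype.card_subtype, ← Fintype.card_subtype,
    ← Nat.card_eq_fintype_card, ← Nat.card_eq_fintype_card] at h1
  simp only [Nat.cast_id] at h1
  refine h1.le.trans (Nat.mul_le_mul_left _ ?_)
  let g : {y : s → Fin C // D.Monochromatic l' y} →
      (W ⊕ {b // D.SplitAt l b} → Fin C) := fun y =>
    Sum.elim (fun b => y.1 (l' false (D.dist b))) fun b => y.1 (l' true (D.dist b))
  have hg : Function.Injective g := by
    rintro ⟨y, hy⟩ ⟨y', hy'⟩ hyy
    have hfalse : ∀ b, y (l' false (D.dist b)) = y' (l' false (D.dist b)) :=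
      fun b => congrFun hyy (Sum.inl b)
    have hall : ∀ i b, y (l' i (D.dist b)) = y' (l' i (D.dist b)) := by
      rintro (_ | _) b
      · exact hfalse b
      · by_cases hb : D.SplitAt l b
        · exact congrFun hyy (Sum.inr ⟨b, hb⟩)
        · obtain ⟨h, h', h2, h3, h4⟩ := exists_eq_of_not_splitAt (hl b) hb
          have h5 : l' false h = l' true h' := Subtype.ext (congrArg f h4)
          have hd := D.vert_dist b
          rw [hy true _ h' (hd.trans h3.symm), hy' true _ h' (hd.trans h3.symm), ← h5,
            hy false _ _ (h2.trans hd.symm), hy' false _ _ (h2.trans hd.symm), hfalse]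
    refine Subtype.ext (funext fun ⟨x, hx⟩ => ?_)
    obtain ⟨z, -, rfl⟩ := Finset.mem_image.1 hx
    obtain ⟨i, h, rfl⟩ := hsurj z
    have hd := (D.vert_dist (D.vert h)).symm
    exact (hy i _ _ hd).trans ((hall _ _).trans (hy' i _ _ hd).symm)
  refine (Nat.card_le_card_of_injective g hg).trans_eq ?_
  have : Fintype {b // D.SplitAt l b} := Fintype.ofFinite _
  rw [Nat.card_fun, Nat.card_sum, Nat.card_eq_fintype_card (α := Fin C), Fintype.card_fin,
    Nat.card_eq_fintype_card (α := W)]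

/-- The graph on the labels, in which the labels of the two halves of an edge are adjacent. -/
def labelGraph {P : Type*} (l : Bool → HalfEdge H → P) : SimpleGraph P :=
  SimpleGraph.fromRel fun x y => ∃ i e, l i (e, false) = x ∧ l i (e, true) = y

/-- The contribution to the variance of all mixed pairs of labellings with the same coincidences
of labels. -/
theorem sum_card_monochromatic_le [Fintype W] [DecidableRel H.Adj] (hconn : H.Connected)
    (hleaf : ∀ b, H.degree b ≠ 1) [Fintype V] {G : SimpleGraph V} [DecidableRel G.Adj]
    {C : ℕ} (hC : 0 < C) (hCΔ : C * G.maxDegree ^ 2 ≤ Fintype.card G.Dart)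
    (hCm : C ^ 3 ≤ Fintype.card G.Dart) {I : Type*} [Fintype I] {col : I → V → Fin C}
    (hcol : KWiseIndependent (4 * Nat.card H.edgeSet) col)
    (s : Finset (Bool → HalfEdge H → V)) (hs : ∀ π ∈ s, D.IsMixed G π)
    (hker : ∀ π ∈ s, ∀ π' ∈ s, ∀ i h i' h', π i h = π i' h' ↔ π' i h = π' i' h') :
    (∑ π ∈ s, Nat.card {i // D.Monochromatic π (col i)}) *
        C ^ (2 * Nat.card H.edgeSet - Fintype.card W) ≤
      Fintype.card G.Dart ^ Nat.card H.edgeSet * Nat.card I := by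
  classical
  rcases s.eq_empty_or_nonempty with rfl | ⟨π₀, hπ₀⟩
  · simp
  have hE := Fintype.ofFinite H.edgeSet
  -- The labels of one pair `π₀` serve as names for those of every pair in `s`, which then differ
  -- only by an injection `P → V`.
  let P := Set.range fun q : Bool × HalfEdge H => π₀ q.1 q.2
  let l : Bool → HalfEdge H → P := fun i h => ⟨π₀ i h, (i, h), rfl⟩
  have hlsurj : ∀ x, ∃ i h, l i h = x := by
    rintro ⟨_, ⟨i, h⟩, rfl⟩
    exact ⟨i, h, rfl⟩
  have hfac : ∀ π ∈ s, ∃ f : P → V, Function.Injective f ∧ π = fun i h => f (l i h) := by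
    intro π hπ
    let f : P → V := fun x => π x.2.choose.1 x.2.choose.2
    have hf : ∀ i h, f (l i h) = π i h := fun i h =>
      (hker π₀ hπ₀ π hπ _ _ _ _).1 (l i h).2.choose_spec
    refine ⟨f, ?_, funext fun i => funext fun h => (hf i h).symm⟩
    intro x y hxy
    obtain ⟨i, h, rfl⟩ := hlsurj x
    obtain ⟨i', h', rfl⟩ := hlsurj y
    rw [hf, hf] at hxy
    exact Subtype.ext ((hker π₀ hπ₀ π hπ _ _ _ _).2 hxy)
  obtain ⟨f₀, hf₀, hπf₀⟩ := hfac π₀ hπ₀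
  have hmix := hs π₀ hπ₀
  have hl : ∀ b, D.ParallelAt l b ∨ D.SwappedAt l b := by
    intro b
    have := hmix.matched b
    rwa [hπf₀, parallelAt_comp_iff hf₀, swappedAt_comp_iff hf₀] at this
  obtain ⟨r, hr⟩ := hmix.not_split
  rw [hπf₀, splitAt_comp_iff hf₀] at hr
  have hne : ∀ i e, l i (e, false) ≠ l i (e, true) := fun i e h =>
    (hmix.adj i e).ne (congrArg Subtype.val h)
  have hadj : ∀ i e, (labelGraph l).Adj (l i (e, false)) (l i (e, true)) := fun i e =>
    (SimpleGraph.fromRel_adj _ _ _).2 ⟨hne i e, Or.inl ⟨i, e, rfl, rfl⟩⟩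
  have hκ : ∀ i h, (labelGraph l).connectedComponentMk (l i (h.1, false)) =
      (labelGraph l).connectedComponentMk (l i h) := by
    rintro i ⟨e, _ | _⟩
    · rfl
    · exact SimpleGraph.ConnectedComponent.sound (hadj i e).reachable
  have hp := card_classes_le (D := D) hconn hleaf hl hr
    (κ := fun e i => (labelGraph l).connectedComponentMk (l i (e, false)))
    (by
      intro x
      induction x using SimpleGraph.ConnectedComponent.ind with | _ x =>
      obtain ⟨i, h, rfl⟩ := hlsurj x
      exact ⟨h.1, i, hκ i h⟩)
    (by
      intro h h' i i' hh
      rw [hκ, hκ, hh])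
  have hn := card_labels_le (D := D) hleaf hl hlsurj
  have hN := card_hom_sq_mul_le G hCΔ (labelGraph l) (by
    intro x
    obtain ⟨i, ⟨e, _ | _⟩, rfl⟩ := hlsurj x
    · exact ⟨_, hadj i e⟩
    · exact ⟨_, (hadj i e).symm⟩)
  -- Thus the subtraction in the exponent `2k - t` is not truncated.
  have ht : Fintype.card W ≤ 2 * Nat.card H.edgeSet := by
    have h1 : Function.Injective D.dist := fun b c h => by
      rw [← D.vert_dist b, h, D.vert_dist]
    have := Nat.card_le_card_of_injective _ h1
    rwa [Nat.card_prod, Nat.card_eq_fintype_card (α := Bool), Fintype.card_bool, mul_comm,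
      Nat.card_eq_fintype_card] at this
  refine mul_pow_sub_le hC hCm hn ht hp hN ?_
  have hscard : s.card ≤ Nat.card (labelGraph l →g G) := by
    have hhom : ∀ π : s, ∃ f : labelGraph l →g G, π.1 = fun i h => f (l i h) := by
      rintro ⟨π, hπ⟩
      obtain ⟨f, hf, rfl⟩ := hfac π hπ
      refine ⟨⟨f, ?_⟩, rfl⟩
      intro x y hxy
      rcases ((SimpleGraph.fromRel_adj _ _ _).1 hxy).2 with ⟨i, e, rfl, rfl⟩ | ⟨i, e, rfl, rfl⟩
      · exact (hs _ hπ).adj i e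
      · exact ((hs _ hπ).adj i e).symm
    choose F hF using hhom
    have : Finite (labelGraph l →g G) := DFunLike.finite _
    have := Nat.card_le_card_of_injective F fun π π' h => Subtype.ext (by rw [hF π, hF π', h])
    simpa using this
  calc _ = ∑ π ∈ s, Nat.card {i // D.Monochromatic π (col i)} * C ^ Nat.card P :=
        Finset.sum_mul _ _ _
    _ ≤ ∑ π ∈ s, Nat.card I * C ^ (Fintype.card W + Nat.card {b // D.SplitAt l b}) := by
        refine Finset.sum_le_sum fun π hπ => ?_
        obtain ⟨f, hf, rfl⟩ := hfac π hπ
        exact card_monochromatic_le hl hlsurj hf hC hcol (hn.trans (by omega))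
    _ = s.card * _ := by rw [Finset.sum_const, smul_eq_mul]
    _ ≤ _ := Nat.mul_le_mul_right _ hscard

/-- The pairs are sorted by the equivalence relation of having equal labels; the number of these
relations depends only on `H`. -/
theorem sum_mixed_le [Fintype W] [DecidableRel H.Adj] (hconn : H.Connected)
    (hleaf : ∀ b, H.degree b ≠ 1) [Fintype V] {G : SimpleGraph V} [DecidableRel G.Adj]
    {C : ℕ} (hC : 0 < C) (hCΔ : C * G.maxDegree ^ 2 ≤ Fintype.card G.Dart)
    (hCm : C ^ 3 ≤ Fintype.card G.Dart) {I : Type*} [Fintype I] {col : I → V → Fin C}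
    (hcol : KWiseIndependent (4 * Nat.card H.edgeSet) col)
    (s : Finset (Bool → HalfEdge H → V)) (hs : ∀ π ∈ s, D.IsMixed G π) :
    (∑ π ∈ s, Nat.card {i // D.Monochromatic π (col i)}) *
        C ^ (2 * Nat.card H.edgeSet - Fintype.card W) ≤
      Nat.card (Setoid (Bool × HalfEdge H)) *
        (Fintype.card G.Dart ^ Nat.card H.edgeSet * Nat.card I) := by
  classical
  have hE := Fintype.ofFinite H.edgeSet
  have : Finite (Setoid (Bool × HalfEdge H)) :=
    Finite.of_injective (fun r => r.r) fun r r' h => Setoid.ext fun a b => by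
      exact iff_of_eq (congrFun (congrFun h a) b)
  have := Fintype.ofFinite (Setoid (Bool × HalfEdge H))
  rw [← Finset.sum_fiberwise (s := s) (g := fun π : Bool → HalfEdge H → V =>
      Setoid.ker fun q : Bool × HalfEdge H => π q.1 q.2), Finset.sum_mul]
  refine (Finset.sum_le_card_nsmul _ _ (Fintype.card G.Dart ^ Nat.card H.edgeSet * Nat.card I)
    fun r _ => ?_).trans_eq
    (by rw [smul_eq_mul, Finset.card_univ, ← Nat.card_eq_fintype_card (α := Setoid _)])
  refine sum_card_monochromatic_le hconn hleaf hC hCΔ hCm hcol _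
    (fun π hπ => hs π (Finset.mem_filter.1 hπ).1) ?_
  intro π hπ π' hπ' i h i' h'
  have h1 := (Finset.mem_filter.1 hπ).2
  rw [← (Finset.mem_filter.1 hπ').2] at h1
  exact iff_of_eq
    (congrArg (fun q : Setoid (Bool × HalfEdge H) => q.r (i, h) (i', h')) h1)

end Directing

/-! ### Characters of the hash groups -/

section Characters

variable {d : ℕ} {𝒢 : Subgroup (Fin d → ℂˣ)}

/-- The character of `𝒢` given by a diagonal entry. -/
def entryChar (𝒢 : Subgroup (Fin d → ℂˣ)) (j : Fin d) : 𝒢 →* ℂˣ :=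
  (Pi.evalMonoidHom _ j).comp 𝒢.subtype

theorem norm_char {A : Type*} [Group A] [Finite A] (φ : A →* ℂˣ) (g : A) : ‖(φ g : ℂ)‖ = 1 := by
  refine Complex.norm_eq_one_of_pow_eq_one (n := Nat.card A) ?_ Nat.card_pos.ne'
  rw [← Units.val_pow_eq_pow_val, ← map_pow, pow_card_eq_one', map_one, Units.val_one]

theorem conj_char {A : Type*} [Group A] [Finite A] (φ : A →* ℂˣ) (g : A) :
    starRingEnd ℂ (φ g : ℂ) = (φ g : ℂ)⁻¹ := by
  rw [Complex.inv_def, Complex.normSq_eq_norm_sq, norm_char]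
  simp

theorem IsHashGroup.pos (h : IsHashGroup d 𝒢) : 0 < d := by
  cases h with
  | roots r hr => exact one_pos
  | signedPowers d hd => omega

/-- In the second kind of group the element `-I` is essential: the first diagonal entry is `1` on
all powers of `M`. -/
theorem IsHashGroup.entryChar_ne_one (h : IsHashGroup d 𝒢) (j : Fin d) :
    entryChar 𝒢 j ≠ 1 := by
  intro h1
  cases h with
  | roots r hr =>
    have hz := Complex.isPrimitiveRoot_exp r (by omega)
    have hu : IsUnit (Complex.exp (2 * Real.pi * Complex.I / r)) :=
      (Complex.exp_ne_zero _).isUnit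
    have hz' : IsPrimitiveRoot hu.unit r := IsPrimitiveRoot.coe_units_iff.1 hz
    have hmem : (fun _ : Fin 1 => hu.unit) ∈ rootsGroup r := by
      refine (Subgroup.mem_pi _).2 fun i _ => ?_
      exact (mem_rootsOfUnity _ _).2 hz'.pow_eq_one
    have h2 : hu.unit = 1 := DFunLike.congr_fun h1 ⟨_, hmem⟩
    exact hz'.ne_one (by omega) h2
  | signedPowers d hd =>
    have hmem : (-1 : Fin d → ℂˣ) ∈ signedPowersGroup d :=
      Subgroup.subset_closure (Or.inr rfl)
    have h2 : (-1 : ℂˣ) = 1 := DFunLike.congr_fun h1 ⟨_, hmem⟩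
    have h3 := congrArg Units.val h2
    norm_num at h3

theorem IsHashGroup.entryChar_injective (h : IsHashGroup d 𝒢) :
    Function.Injective (entryChar 𝒢) := by
  intro i j hij
  cases h with
  | roots r hr => exact Subsingleton.elim _ _
  | signedPowers d hd =>
    have hmem : (fun j : Fin d => omega d ^ (j : ℕ)) ∈ signedPowersGroup d :=
      Subgroup.subset_closure (Or.inl rfl)
    have h2 : omega d ^ (i : ℕ) = omega d ^ (j : ℕ) := DFunLike.congr_fun hij ⟨_, hmem⟩
    have hz : IsPrimitiveRoot (omega d) d :=
      IsPrimitiveRoot.coe_units_iff.1 (Complex.isPrimitiveRoot_exp d (by omega))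
    exact Fin.ext (hz.pow_inj i.2 j.2 h2)

/-- Two elements of a group, of which the second or its inverse equals the first. -/
def SpecialPair {M : Type*} [Group M] (θ θ' : M) : Prop := θ = θ' ∨ θ = θ'⁻¹

-- The entries of `M` are distinct, so for a given second entry at most one first entry has an equal
-- character, and at most one an inverse character.
open Classical in
theorem IsHashGroup.card_special_le (h : IsHashGroup d 𝒢) :
    (Finset.univ.filter fun p : Fin d × Fin d =>
      SpecialPair (entryChar 𝒢 p.1) (entryChar 𝒢 p.2)).card ≤ 2 * d := by
  have hsub : (Finset.univ.filter fun p : Fin d × Fin d =>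
      SpecialPair (entryChar 𝒢 p.1) (entryChar 𝒢 p.2)) ⊆
      (Finset.univ.filter fun p : Fin d × Fin d => entryChar 𝒢 p.1 = entryChar 𝒢 p.2) ∪
      (Finset.univ.filter fun p : Fin d × Fin d => entryChar 𝒢 p.1 = (entryChar 𝒢 p.2)⁻¹) := by
    intro p hp
    rw [Finset.mem_union, Finset.mem_filter, Finset.mem_filter]
    exact (Finset.mem_filter.1 hp).2.imp (fun h => ⟨Finset.mem_univ _, h⟩)
      fun h => ⟨Finset.mem_univ _, h⟩
  have key : ∀ F : Fin d → (𝒢 →* ℂˣ), (Finset.univ.filter fun p : Fin d × Fin d =>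
      entryChar 𝒢 p.1 = F p.2).card ≤ d := by
    intro F
    have := Finset.card_le_card_of_injOn (s := Finset.univ.filter fun p : Fin d × Fin d =>
      entryChar 𝒢 p.1 = F p.2) (t := Finset.univ) Prod.snd
      (fun _ _ => Finset.mem_coe.2 (Finset.mem_univ _)) (by
        intro p hp q hq hpq
        have hp' := (Finset.mem_filter.1 hp).2
        have hq' := (Finset.mem_filter.1 hq).2
        rw [hpq, ← hq'] at hp'
        exact Prod.ext (h.entryChar_injective hp') hpq)
    simpa using this
  calc _ ≤ _ := Finset.card_le_card hsub
    _ ≤ _ := Finset.card_union_le _ _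
    _ ≤ d + d := Nat.add_le_add (key _) (key fun j => (entryChar 𝒢 j)⁻¹)
    _ = _ := by ring

/-- The ways in which the points of four characters `θ`, `θ⁻¹`, `θ'⁻¹`, `θ'` can coincide such that
the average over independent hash functions does not vanish. -/
def Coincide {V M : Type*} [Group M] (θ θ' : M) (a b a' b' : V) : Prop :=
  (a = b ∧ a' = b') ∨ (SpecialPair θ θ' ∧ ((a = a' ∧ b = b') ∨ (a = b' ∧ b = a')))

/-- A point different from the other three would carry a nontrivial character alone, so the points
coincide in pairs. Pairing `a` with `a'` or `b'` forces `θ = θ'` or `θ = θ'⁻¹`. Only the four points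
themselves have to be tested as `v`. -/
theorem coincide_of_forall_mul_eq_one {V M : Type*} [CommGroup M] [DecidableEq V]
    {θ θ' : M} (hθ : θ ≠ 1) (hθ' : θ' ≠ 1) {a b a' b' : V}
    (h : ∀ v, (if a = v then θ else 1) * (if b = v then θ⁻¹ else 1) *
      (if a' = v then θ'⁻¹ else 1) * (if b' = v then θ' else 1) = 1) :
    Coincide θ θ' a b a' b' := by
  classical
  have ha := h a
  have hb := h b
  have ha' := h a'
  have hb' := h b'
  clear h
  unfold Coincide SpecialPair
  by_cases h1 : a = b <;> by_cases h2 : a = a' <;> by_cases h3 : a = b' <;>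
    by_cases h4 : b = a' <;> by_cases h5 : b = b' <;> by_cases h6 : a' = b' <;>
    simp_all [eq_comm, mul_eq_one_iff_eq_inv]

open Classical in
theorem norm_sum_four_le {V A J : Type*} [CommGroup A] [Finite A] [Fintype J]
    {N : ℕ} {x : J → V → A} (hx : KWiseIndependent N x) (hN : 4 ≤ N)
    {θ θ' : A →* ℂˣ} (hθ : θ ≠ 1) (hθ' : θ' ≠ 1) (a b a' b' : V) :
    ‖∑ i, (θ (x i a) : ℂ) * (θ (x i b) : ℂ)⁻¹ * (θ' (x i a') : ℂ)⁻¹ * (θ' (x i b') : ℂ)‖ ≤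
      Nat.card J * if Coincide θ θ' a b a' b' then 1 else 0 := by
  split_ifs with hc
  · refine (norm_sum_le _ _).trans ?_
    simp only [norm_mul, norm_inv, norm_char, inv_one, mul_one, Finset.sum_const,
      Finset.card_univ, nsmul_eq_mul, Nat.card_eq_fintype_card, le_refl]
  · have h1 : ∃ v, ¬ (if a = v then θ else 1) * (if b = v then θ⁻¹ else 1) *
      (if a' = v then θ'⁻¹ else 1) * (if b' = v then θ' else 1) = 1 := by
      by_contra! h
      exact hc (coincide_of_forall_mul_eq_one hθ hθ' h)
    obtain ⟨v, hv⟩ := h1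
    have hprod : (∏ l with ![a, b, a', b'] l = v, ![θ, θ⁻¹, θ'⁻¹, θ'] l) ≠ 1 := by
      rw [Finset.prod_filter, Fin.prod_univ_four]
      exact hv
    have h2 := hx.sum_prod_char_eq_zero (L := Fin 4) (by simpa using hN) _ _ hprod
    have h3 : ∑ i, (θ (x i a) : ℂ) * (θ (x i b) : ℂ)⁻¹ * (θ' (x i a') : ℂ)⁻¹ *
        (θ' (x i b') : ℂ) = 0 := by
      rw [← h2]
      refine Finset.sum_congr rfl fun i _ => ?_
      rw [Fin.prod_univ_four]
      simp
    rw [h3, norm_zero, mul_zero]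

end Characters

/-! ### Copies of `H` and the normalizing factor -/

section Copies

/-- The inequality holds factor by factor: `C ≤ t * (C - i)` for `i < t ≤ C`. -/
theorem pow_le_pow_mul_descFactorial {t C : ℕ} (h : t ≤ C) :
    C ^ t ≤ t ^ t * C.descFactorial t := by
  have h1 : ∀ a : ℕ, a ^ t = ∏ i ∈ Finset.range t, a := fun a => by
    rw [Finset.prod_const, Finset.card_range]
  rw [Nat.descFactorial_eq_prod_range, h1, h1, ← Finset.prod_mul_distrib]
  refine Finset.prod_le_prod' fun i hi => ?_
  have hi := Finset.mem_range.1 hi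
  obtain ⟨a, rfl⟩ := Nat.exists_eq_add_of_le h
  obtain ⟨b, rfl⟩ := Nat.exists_eq_add_of_lt hi
  have : i + b + 1 + a - i = b + 1 + a := by omega
  rw [this]
  nlinarith [Nat.zero_le (i * b), Nat.zero_le (i * a), Nat.zero_le (b * a), Nat.zero_le (b * b)]

/-- Once one embedding with a given image is fixed, any other with that image is determined by a
self-map of the vertices of `H`. This cruder count suffices in place of automorphisms. -/
theorem labelledCopyCount_le {W V : Type*} [Fintype W] [Fintype V] (G : SimpleGraph V)
    (H : SimpleGraph W) :
    G.labelledCopyCount H ≤ Fintype.card W ^ Fintype.card W * G.copyCount H := by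
  classical
  rw [SimpleGraph.copyCount_eq_card_image_copyToSubgraph, SimpleGraph.labelledCopyCount]
  refine Finset.card_le_mul_card_image Finset.univ _ ?_
  intro B hB
  obtain ⟨f, -, hf⟩ := Finset.mem_image.1 hB
  have hverts : ∀ (g : H.Copy G), g.toSubgraph = B → ∀ w, ∃ w', f w' = g w := by
    intro g hg w
    have h1 : g w ∈ g.toSubgraph.verts := ⟨w, trivial, rfl⟩
    rw [hg, ← hf] at h1
    obtain ⟨w', -, hw'⟩ := h1
    exact ⟨w', hw'⟩
  let F : {g : H.Copy G // g.toSubgraph = B} → W → W := fun g w => (hverts g.1 g.2 w).choose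
  have hF : ∀ g w, f (F g w) = g.1 w := fun g w => (hverts g.1 g.2 w).choose_spec
  have hinj : Function.Injective F := fun g g' h => Subtype.ext <| DFunLike.ext _ _ fun w => by
    rw [← hF, ← hF, h]
  have := Fintype.card_le_of_injective F hinj
  rwa [Fintype.card_subtype, Fintype.card_fun] at this

end Copies

/-! ### Second moments and variance -/

open Classical in
/-- The second moment of a sum of products of independent factors is at most the number of pairs of
terms, weighted by `B`, for which the averages of all factors do not vanish. -/
theorem sum_norm_sq_sum_mul_prod_le {I J F K : Type*} [Fintype I] [Fintype J] [Fintype F]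
    [DecidableEq F] [Fintype K] (B : I → K → ℕ) (u : F → K → J → ℂ) (p : F → K → K → Prop)
    (hu : ∀ h a b, ‖∑ y, u h a y * starRingEnd ℂ (u h b y)‖ ≤
      Nat.card J * if p h a b then 1 else 0) :
    ∑ ω : I × (F → J), ‖∑ a, (B ω.1 a : ℂ) * ∏ h, u h a (ω.2 h)‖ ^ 2 ≤
      (Nat.card J : ℝ) ^ Fintype.card F *
        ∑ a, ∑ b, if ∀ h, p h a b then ∑ i, (B i a * B i b : ℝ) else 0 := by
  have h1 : ((∑ ω : I × (F → J), ‖∑ a, (B ω.1 a : ℂ) * ∏ h, u h a (ω.2 h)‖ ^ 2 : ℝ) : ℂ) =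
      ∑ a, ∑ b, (∑ i, (B i a * B i b : ℂ)) *
        ∏ h, ∑ y, u h a y * starRingEnd ℂ (u h b y) := by
    push_cast
    simp only [← Complex.mul_conj', map_sum, map_mul, map_prod, Complex.conj_natCast,
      Finset.sum_mul_sum]
    rw [Finset.sum_comm]
    refine Finset.sum_congr rfl fun a _ => ?_
    rw [Finset.sum_comm]
    refine Finset.sum_congr rfl fun b _ => ?_
    rw [Fintype.prod_sum, Finset.sum_mul_sum, Fintype.sum_prod_type]
    refine Finset.sum_congr rfl fun i _ => Finset.sum_congr rfl fun y _ => ?_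
    rw [Finset.prod_mul_distrib]
    ring
  have h2 : 0 ≤ ∑ ω : I × (F → J), ‖∑ a, (B ω.1 a : ℂ) * ∏ h, u h a (ω.2 h)‖ ^ 2 :=
    Finset.sum_nonneg fun _ _ => by positivity
  rw [← Complex.norm_of_nonneg h2, h1, Finset.mul_sum]
  refine (norm_sum_le _ _).trans (Finset.sum_le_sum fun a _ => ?_)
  rw [Finset.mul_sum]
  refine (norm_sum_le _ _).trans (Finset.sum_le_sum fun b _ => ?_)
  have h3 : ‖∑ i, (B i a * B i b : ℂ)‖ = ∑ i, (B i a * B i b : ℝ) := by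
    have h4 : (∑ i, (B i a * B i b : ℂ)) = ((∑ i, (B i a * B i b : ℝ) : ℝ) : ℂ) := by
      push_cast; rfl
    rw [h4, Complex.norm_of_nonneg (Finset.sum_nonneg fun _ _ => by positivity)]
  rw [norm_mul, h3, norm_prod]
  have h5 : ∏ h, ‖∑ y, u h a y * starRingEnd ℂ (u h b y)‖ ≤
      (Nat.card J : ℝ) ^ Fintype.card F * if ∀ h, p h a b then 1 else 0 := by
    refine (Finset.prod_le_prod (fun _ _ => norm_nonneg _) fun h _ => hu h a b).trans_eq ?_
    rw [Finset.prod_mul_distrib, Finset.prod_const, Finset.card_univ, Finset.prod_ite_zero]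
    simp
  refine (mul_le_mul_of_nonneg_left h5
    (Finset.sum_nonneg fun _ _ => by positivity)).trans_eq ?_
  split_ifs
  · ring
  · simp

theorem complexVariance_le {Ω : Type*} [Fintype Ω] [Nonempty Ω] (f : Ω → ℂ) :
    complexVariance f ≤ (∑ ω, ‖f ω‖ ^ 2) / Fintype.card Ω := by
  have hc : (Fintype.card Ω : ℝ) ≠ 0 := by exact_mod_cast Fintype.card_ne_zero
  unfold complexVariance
  set μ := 𝔼 ω, f ω with hμ
  have hμ' : ∑ ω, f ω = Fintype.card Ω * μ := by
    rw [hμ, Fintype.expect_eq_sum_div_card, mul_div_cancel₀]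
    exact_mod_cast hc
  rw [Fintype.expect_eq_sum_div_card]
  refine div_le_div_of_nonneg_right ?_ (Nat.cast_nonneg _)
  have h1 : ∀ ω, ‖f ω - μ‖ ^ 2 = ‖f ω‖ ^ 2 + ‖μ‖ ^ 2 - 2 * (f ω * starRingEnd ℂ μ).re := by
    intro ω
    rw [← Complex.normSq_eq_norm_sq, ← Complex.normSq_eq_norm_sq, ← Complex.normSq_eq_norm_sq,
      Complex.normSq_sub]
  simp only [h1]
  rw [Finset.sum_sub_distrib, Finset.sum_add_distrib, ← Finset.mul_sum, ← Complex.re_sum,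
    ← Finset.sum_mul, hμ', mul_assoc, Complex.mul_conj']
  have h2 : ((Fintype.card Ω : ℂ) * (‖μ‖ : ℂ) ^ 2).re = Fintype.card Ω * ‖μ‖ ^ 2 := by
    norm_cast
  rw [h2, Finset.sum_const, Finset.card_univ, nsmul_eq_mul]
  nlinarith [mul_nonneg (Nat.cast_nonneg (α := ℝ) (Fintype.card Ω)) (sq_nonneg ‖μ‖)]

/-! ### The trace as a sum over assignments of darts -/

section Labels

variable {W : Type u} {H : SimpleGraph W} {V : Type v} {G : SimpleGraph V}

/-- The labelling of half-edges by vertices given by an assignment of darts to edges. -/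
def dartLabel (φ : H.edgeSet → G.Dart) : HalfEdge H → V
  | (e, false) => (φ e).fst
  | (e, true) => (φ e).snd

theorem dartLabel_injective :
    Function.Injective (dartLabel : (H.edgeSet → G.Dart) → HalfEdge H → V) := by
  intro φ φ' h
  funext e
  exact SimpleGraph.Dart.ext _ _ (Prod.ext (congrFun h (e, false)) (congrFun h (e, true)))

variable (D : Directing H)

open Classical in
/-- The number of tuples of distinct colors that agree with the colors of the labels. -/
noncomputable def colorCount [Fintype W] {C : ℕ} (col : V → Fin C) (l : HalfEdge H → V) : ℕ :=
  (Finset.univ.filter fun c : W → Fin C =>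
    Function.Injective c ∧ ∀ h, col (l h) = c (D.vert h)).card

variable {D}

theorem colorCount_le_one [Fintype W] {C : ℕ} (col : V → Fin C) (l : HalfEdge H → V) :
    colorCount D col l ≤ 1 := by
  classical
  refine Finset.card_le_one.2 fun c hc c' hc' => funext fun b => ?_
  have h1 := (Finset.mem_filter.1 hc).2.2 (D.dist b)
  have h2 := (Finset.mem_filter.1 hc').2.2 (D.dist b)
  rw [D.vert_dist] at h1 h2
  rw [← h1, h2]

theorem exists_of_colorCount_ne_zero [Fintype W] {C : ℕ} {col : V → Fin C} {l : HalfEdge H → V}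
    (h : colorCount D col l ≠ 0) :
    ∃ c : W → Fin C, Function.Injective c ∧ ∀ h, col (l h) = c (D.vert h) := by
  classical
  obtain ⟨c, hc⟩ := Finset.card_ne_zero.1 h
  exact ⟨c, (Finset.mem_filter.1 hc).2⟩

-- Distributing each distinguished hash over the free half-edges at its vertex makes every free hash
-- occur once at its own label and once inverted. At a vertex with constant labels these cancel.
open Classical in
theorem prod_allHashes [Fintype W] [DecidableEq W] [DecidableRel H.Adj] {d : ℕ}
    {𝒢 : Subgroup (Fin d → ℂˣ)} (X : D.FreeHalfEdge → V → 𝒢) (l : HalfEdge H → V) :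
    ∏ h : HalfEdge H, allHashes D X h (l h) =
      ∏ h : D.FreeHalfEdge, X h (l h.1) * (X h (l (D.dist (D.vert h.1))))⁻¹ := by
  have h1 : ∀ h : HalfEdge H, allHashes D X h (l h) =
      if hd : D.Distinguished h then
        ∏ j : D.FreeHalfEdge with D.vert j.1 = D.vert h, (X j (l h))⁻¹
      else X ⟨h, hd⟩ (l h) := fun h => rfl
  rw [Finset.prod_congr rfl fun h _ => h1 h, Fintype.prod_dite, Finset.prod_mul_distrib, mul_comm]
  congr 1
  have hd : ∀ b, D.Distinguished (D.dist b) := fun b => by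
    unfold Directing.Distinguished
    rw [D.vert_dist]
  rw [← Finset.prod_fiberwise (s := Finset.univ)
    (g := fun j : D.FreeHalfEdge => (⟨D.dist (D.vert j.1), hd _⟩ : {h // D.Distinguished h}))]
  refine Finset.prod_congr rfl fun h _ => ?_
  have h2 : ∀ j : D.FreeHalfEdge, D.vert j.1 = D.vert h.1 ↔
      (⟨D.dist (D.vert j.1), hd _⟩ : {h // D.Distinguished h}) = h := by
    intro j
    rw [Subtype.ext_iff]
    constructor
    · intro hj
      rw [hj]
      exact h.2.symm
    · intro hj
      rw [← hj, D.vert_dist]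
  rw [Finset.filter_congr fun j _ => h2 j]
  refine Finset.prod_congr rfl fun j hj => ?_
  have h3 := congrArg Subtype.val (Finset.mem_filter.1 hj).2
  simp only at h3
  rw [h3]

open Classical in
theorem totalSum_apply [Fintype W] [DecidableEq W] [DecidableRel H.Adj] [Fintype V]
    [DecidableEq V] [DecidableRel G.Adj] {C d : ℕ} {𝒢 : Subgroup (Fin d → ℂˣ)}
    (col : V → Fin C) (X : D.FreeHalfEdge → V → 𝒢) (j : Fin d) :
    totalSum D G col X j = ∑ φ : H.edgeSet → G.Dart, (colorCount D col (dartLabel φ) : ℂ) *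
      ∏ h : D.FreeHalfEdge, ((entryChar 𝒢 j (X h (dartLabel φ h.1)) : ℂ) *
        (entryChar 𝒢 j (X h (dartLabel φ (D.dist (D.vert h.1)))) : ℂ)⁻¹) := by
  have hprod : ∀ φ : H.edgeSet → G.Dart,
      ∏ e, diagEntries (edgeHash D G X e (φ e)) j =
      ∏ h : D.FreeHalfEdge, ((entryChar 𝒢 j (X h (dartLabel φ h.1)) : ℂ) *
        (entryChar 𝒢 j (X h (dartLabel φ (D.dist (D.vert h.1)))) : ℂ)⁻¹) := by
    intro φ
    have h1 : ∏ e, diagEntries (edgeHash D G X e (φ e)) j =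
        (entryChar 𝒢 j (∏ h : HalfEdge H, allHashes D X h (dartLabel φ h)) : ℂ) := by
      rw [Fintype.prod_prod_type, map_prod, Units.coe_prod]
      refine Finset.prod_congr rfl fun e _ => ?_
      rw [Fintype.prod_bool, mul_comm]
      rfl
    rw [h1, prod_allHashes, map_prod, Units.coe_prod]
    refine Finset.prod_congr rfl fun h _ => ?_
    rw [map_mul, map_inv, Units.val_mul, Units.val_inv_eq_inv_val]
  have hcolor : ∀ c : W → Fin C, colorProd D G col X c j = ∑ φ : H.edgeSet → G.Dart,
      if ∀ h, col (dartLabel φ h) = c (D.vert h) then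
        ∏ e, diagEntries (edgeHash D G X e (φ e)) j else 0 := by
    intro c
    unfold colorProd edgeSum
    simp only [Finset.prod_apply, Finset.sum_apply, Finset.sum_filter, ite_apply, Pi.zero_apply]
    rw [Fintype.prod_sum]
    refine Finset.sum_congr rfl fun φ _ => ?_
    rw [Finset.prod_ite_zero]
    split_ifs with h1 h2 h2
    · rfl
    · refine absurd ?_ h2
      rintro ⟨e, _ | _⟩
      · exact (h1 e (Finset.mem_univ _)).1
      · exact (h1 e (Finset.mem_univ _)).2
    · exact absurd (fun e _ => ⟨h2 (e, false), h2 (e, true)⟩) h1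
    · rfl
  unfold totalSum
  simp only [Finset.sum_apply, hcolor]
  rw [Finset.sum_comm]
  refine Finset.sum_congr rfl fun φ _ => ?_
  rw [← Finset.sum_filter, Finset.filter_filter, Finset.sum_const, nsmul_eq_mul, hprod, colorCount]
  congr!

end Labels

/-! ### Which pairs of terms survive, and their total -/

section Moments

variable {W : Type u} {H : SimpleGraph W} {V : Type v} {G : SimpleGraph V}

/-- The labels of the half-edges at each vertex of `H` agree. -/
def Consistent (D : Directing H) (l : HalfEdge H → V) : Prop :=
  ∀ h, l h = l (D.dist (D.vert h))

/-- A pair of labellings. -/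
def pairLabel (l l' : HalfEdge H → V) : Bool → HalfEdge H → V
  | false => l
  | true => l'

variable {D : Directing H}

theorem consistent_or_isMixed {M : Type*} [Group M] {θ θ' : M} {φ φ' : H.edgeSet → G.Dart}
    (h : ∀ h : D.FreeHalfEdge, Coincide θ θ' (dartLabel φ h.1)
      (dartLabel φ (D.dist (D.vert h.1))) (dartLabel φ' h.1)
      (dartLabel φ' (D.dist (D.vert h.1)))) :
    (Consistent D (dartLabel φ) ∧ Consistent D (dartLabel φ')) ∨
      (SpecialPair θ θ' ∧ D.IsMixed G (pairLabel (dartLabel φ) (dartLabel φ'))) := by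
  set l := dartLabel φ
  set l' := dartLabel φ'
  have hall : ∀ h : HalfEdge H, Coincide θ θ' (l h) (l (D.dist (D.vert h))) (l' h)
      (l' (D.dist (D.vert h))) := by
    intro h1
    by_cases hd : D.Distinguished h1
    · have hd' : D.dist (D.vert h1) = h1 := hd.symm
      exact Or.inl ⟨by rw [hd'], by rw [hd']⟩
    · exact h ⟨h1, hd⟩
  by_cases hc : Consistent D l ∧ Consistent D l'
  · exact Or.inl hc
  refine Or.inr ⟨?_, ?_, ?_, ?_⟩
  · by_contra hs
    refine hc ⟨fun h1 => ?_, fun h1 => ?_⟩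
    · rcases hall h1 with h2 | h2
      · exact h2.1
      · exact absurd h2.1 hs
    · rcases hall h1 with h2 | h2
      · exact h2.2
      · exact absurd h2.1 hs
  · rintro (_ | _) e
    · exact (φ e).adj
    · exact (φ' e).adj
  · intro b
    have hb : ∀ h1, D.vert h1 = b → (l h1 = l (D.dist b) ∧ l' h1 = l' (D.dist b)) ∨
        ((l h1 = l' h1 ∧ l (D.dist b) = l' (D.dist b)) ∨
          (l h1 = l' (D.dist b) ∧ l (D.dist b) = l' h1)) := by
      rintro h1 rfl
      exact (hall h1).imp id And.right
    -- The distinguished half-edge decides: equal labels there make the vertex parallel, different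
    -- ones make it swapped.
    by_cases he : l (D.dist b) = l' (D.dist b)
    · left
      intro h1 hv
      change l h1 = l' h1
      rcases hb h1 hv with h2 | h2 | h2
      · rw [h2.1, h2.2, he]
      · exact h2.1
      · rw [h2.1, ← h2.2, he]
    · right
      have hj : ∀ h1, D.vert h1 = b → ∃ j, ∀ i,
          pairLabel l l' i h1 = pairLabel l l' (xor i j) (D.dist b) := by
        intro h1 hv
        rcases hb h1 hv with h2 | h2 | h2
        · refine ⟨false, ?_⟩
          rintro (_ | _)
          · exact h2.1
          · exact h2.2
        · exact absurd h2.2 he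
        · refine ⟨true, ?_⟩
          rintro (_ | _)
          · exact h2.1
          · exact h2.2.symm
      intro h1 h2 hv1 hv2
      obtain ⟨j1, hj1⟩ := hj h1 hv1
      obtain ⟨j2, hj2⟩ := hj h2 hv2
      refine ⟨xor j1 j2, fun i => ?_⟩
      rw [hj1, hj2, ← Bool.xor_assoc, Bool.xor_assoc _ j2 j2, Bool.xor_self, Bool.xor_false]
  · by_contra! hs
    exact hc ⟨fun h1 => (hs (D.vert h1)).1 h1 rfl false, fun h1 => (hs (D.vert h1)).1 h1 rfl true⟩

theorem labelledCopyCount_eq_card [Fintype W] [Fintype V] :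
    G.labelledCopyCount H = Nat.card (H.Copy G) := by
  classical exact (Nat.card_eq_fintype_card).symm

-- A consistent labelling is a homomorphism from `H` to `G`, and the distinct colors make it
-- injective. The assignment of darts can be recovered from this copy.
open Classical in
theorem sum_consistent_colorCount_le [Fintype W] [Fintype V]
    [Fintype (H.edgeSet → G.Dart)] {C : ℕ} (col : V → Fin C) :
    ∑ φ : H.edgeSet → G.Dart, (if Consistent D (dartLabel φ) then
      colorCount D col (dartLabel φ) else 0) ≤ G.labelledCopyCount H := by
  rw [← Finset.sum_filter]
  have h1 : ∑ φ : H.edgeSet → G.Dart with Consistent D (dartLabel φ),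
      colorCount D col (dartLabel φ) ≤ (Finset.univ.filter fun φ : H.edgeSet → G.Dart =>
        Consistent D (dartLabel φ) ∧ colorCount D col (dartLabel φ) ≠ 0).card := by
    rw [← Finset.filter_filter, Finset.card_filter]
    refine Finset.sum_le_sum fun φ _ => ?_
    have := colorCount_le_one (D := D) col (dartLabel φ)
    split_ifs <;> omega
  refine h1.trans ?_
  have h2 : (Finset.univ.filter fun φ : H.edgeSet → G.Dart =>
      Consistent D (dartLabel φ) ∧ colorCount D col (dartLabel φ) ≠ 0).card =
      Nat.card {φ : H.edgeSet → G.Dart //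
        Consistent D (dartLabel φ) ∧ colorCount D col (dartLabel φ) ≠ 0} := by
    rw [Nat.card_eq_fintype_card, Fintype.card_subtype]
  rw [h2, labelledCopyCount_eq_card]
  have hcopy : ∀ φ : {φ : H.edgeSet → G.Dart //
      Consistent D (dartLabel φ) ∧ colorCount D col (dartLabel φ) ≠ 0},
      ∃ f : H.Copy G, ∀ b, f b = dartLabel φ.1 (D.dist b) := by
    rintro ⟨φ, hφ, hcol⟩
    obtain ⟨c, hc, hc'⟩ := exists_of_colorCount_ne_zero hcol
    refine ⟨⟨⟨fun b => dartLabel φ (D.dist b), ?_⟩, ?_⟩, fun b => rfl⟩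
    · intro b b' hbb'
      obtain ⟨h, rfl, rfl⟩ := D.exists_halfEdge_of_adj hbb'
      rw [← hφ h, ← hφ (Directing.opp h)]
      obtain ⟨e, _ | _⟩ := h
      · exact (φ e).adj
      · exact (φ e).adj.symm
    · intro b b' hbb'
      have h2 := hc' (D.dist b)
      have h3 := hc' (D.dist b')
      rw [D.vert_dist] at h2 h3
      refine hc (h2.symm.trans (Eq.trans ?_ h3))
      exact congrArg col hbb'
  choose F hF using hcopy
  refine Nat.card_le_card_of_injective F fun φ φ' h => Subtype.ext (dartLabel_injective ?_)
  funext h'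
  rw [φ.2.1 h', φ'.2.1 h', ← hF, ← hF, h]

theorem monochromatic_of_colorCount [Fintype W] {C : ℕ} {col : V → Fin C}
    {l l' : HalfEdge H → V} (h : colorCount D col l ≠ 0) (h' : colorCount D col l' ≠ 0) :
    D.Monochromatic (pairLabel l l') col := by
  obtain ⟨c, -, hc⟩ := exists_of_colorCount_ne_zero h
  obtain ⟨c', -, hc'⟩ := exists_of_colorCount_ne_zero h'
  rintro (_ | _) h1 h2 hh
  · exact (hc h1).trans ((congrArg c hh).trans (hc h2).symm)
  · exact (hc' h1).trans ((congrArg c' hh).trans (hc' h2).symm)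

open Classical in
theorem sum_isMixed_le [Fintype W] [Fintype V] [Fintype (H.edgeSet → G.Dart)]
    [Fintype (Bool → HalfEdge H → V)] {C : ℕ} {I : Type*} [Fintype I] (col : I → V → Fin C) :
    ∑ φ : H.edgeSet → G.Dart, ∑ φ' : H.edgeSet → G.Dart,
      (if D.IsMixed G (pairLabel (dartLabel φ) (dartLabel φ')) then
        ∑ i, colorCount D (col i) (dartLabel φ) * colorCount D (col i) (dartLabel φ') else 0) ≤
    ∑ π : Bool → HalfEdge H → V with D.IsMixed G π,
      Nat.card {i // D.Monochromatic π (col i)} := by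
  rw [← Fintype.sum_prod_type', ← Finset.sum_filter]
  have hinj : Set.InjOn (fun q : (H.edgeSet → G.Dart) × (H.edgeSet → G.Dart) =>
      pairLabel (dartLabel q.1) (dartLabel q.2)) Set.univ := by
    intro q _ q' _ hqq'
    exact Prod.ext (dartLabel_injective (congrFun hqq' false))
      (dartLabel_injective (congrFun hqq' true))
  calc _ ≤ ∑ q : (H.edgeSet → G.Dart) × (H.edgeSet → G.Dart) with
        D.IsMixed G (pairLabel (dartLabel q.1) (dartLabel q.2)),
        Nat.card {i // D.Monochromatic (pairLabel (dartLabel q.1) (dartLabel q.2)) (col i)} := by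
        refine Finset.sum_le_sum fun q _ => ?_
        rw [Nat.card_eq_fintype_card, Fintype.card_subtype, Finset.card_filter]
        refine Finset.sum_le_sum fun i _ => ?_
        have h1 := colorCount_le_one (D := D) (col i) (dartLabel q.1)
        have h2 := colorCount_le_one (D := D) (col i) (dartLabel q.2)
        split_ifs with hm
        · exact Nat.mul_le_mul h1 h2
        · rw [Nat.le_zero, mul_eq_zero]
          by_contra! hne
          exact hm (monochromatic_of_colorCount hne.1 hne.2)
    _ = ∑ π ∈ (Finset.univ.filter fun q : (H.edgeSet → G.Dart) × (H.edgeSet → G.Dart) =>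
          D.IsMixed G (pairLabel (dartLabel q.1) (dartLabel q.2))).image
          (fun q => pairLabel (dartLabel q.1) (dartLabel q.2)),
          Nat.card {i // D.Monochromatic π (col i)} := by
        rw [Finset.sum_image fun q _ q' _ h => hinj trivial trivial h]
    _ ≤ _ := by
        refine Finset.sum_le_sum_of_subset fun π hπ => ?_
        obtain ⟨q, hq, rfl⟩ := Finset.mem_image.1 hπ
        exact Finset.mem_filter.2 ⟨Finset.mem_univ _, (Finset.mem_filter.1 hq).2⟩

-- All `d ^ 2` pairs of diagonal entries may contribute to the consistent part, but only the at most
-- `2 * d` special ones to the mixed part.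
open Classical in
theorem sum_norm_trace_sq_le [Fintype W] [DecidableEq W] [DecidableRel H.Adj] [Fintype V]
    [DecidableEq V] [DecidableRel G.Adj] {C d : ℕ} {𝒢 : Subgroup (Fin d → ℂˣ)} [Finite 𝒢]
    (h𝒢 : IsHashGroup d 𝒢) {I J : Type*} [Fintype I] [Fintype J] (col : I → V → Fin C)
    {x : J → V → 𝒢} {N : ℕ} (hx : KWiseIndependent N x) (hN : 4 ≤ N) :
    ∑ ω : I × (D.FreeHalfEdge → J),
      ‖Matrix.trace (Matrix.diagonal (totalSum D G (col ω.1) fun h => x (ω.2 h)))‖ ^ 2 ≤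
    (Nat.card J : ℝ) ^ Fintype.card D.FreeHalfEdge *
      ((d : ℝ) ^ 2 * Nat.card I * (G.labelledCopyCount H : ℝ) ^ 2 +
        2 * d * ((∑ π : Bool → HalfEdge H → V with D.IsMixed G π,
          Nat.card {i // D.Monochromatic π (col i)} : ℕ) : ℝ)) := by
  let u : D.FreeHalfEdge → Fin d × (H.edgeSet → G.Dart) → J → ℂ := fun h a y =>
    (entryChar 𝒢 a.1 (x y (dartLabel a.2 h.1)) : ℂ) *
        (entryChar 𝒢 a.1 (x y (dartLabel a.2 (D.dist (D.vert h.1)))) : ℂ)⁻¹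
  let B : I → Fin d × (H.edgeSet → G.Dart) → ℕ := fun i a =>
    colorCount D (col i) (dartLabel a.2)
  let p : D.FreeHalfEdge → Fin d × (H.edgeSet → G.Dart) → Fin d × (H.edgeSet → G.Dart) → Prop :=
    fun h a b => Coincide (entryChar 𝒢 a.1) (entryChar 𝒢 b.1) (dartLabel a.2 h.1)
      (dartLabel a.2 (D.dist (D.vert h.1))) (dartLabel b.2 h.1)
      (dartLabel b.2 (D.dist (D.vert h.1)))
  have htr : ∀ ω : I × (D.FreeHalfEdge → J),
      Matrix.trace (Matrix.diagonal (totalSum D G (col ω.1) fun h => x (ω.2 h))) =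
      ∑ a, (B ω.1 a : ℂ) * ∏ h, u h a (ω.2 h) := by
    intro ω
    rw [Matrix.trace_diagonal, Fintype.sum_prod_type]
    exact Finset.sum_congr rfl fun j _ => totalSum_apply _ _ _
  have hu : ∀ h a b, ‖∑ y, u h a y * starRingEnd ℂ (u h b y)‖ ≤
      Nat.card J * if p h a b then 1 else 0 := by
    intro h a b
    have h1 := norm_sum_four_le hx hN (h𝒢.entryChar_ne_one a.1) (h𝒢.entryChar_ne_one b.1)
      (dartLabel a.2 h.1) (dartLabel a.2 (D.dist (D.vert h.1))) (dartLabel b.2 h.1)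
      (dartLabel b.2 (D.dist (D.vert h.1)))
    refine le_of_eq_of_le (congrArg norm (Finset.sum_congr rfl fun y _ => ?_)) h1
    simp only [u, map_mul, map_inv₀, conj_char, inv_inv, mul_assoc]
  simp only [htr]
  refine (sum_norm_sq_sum_mul_prod_le B u p hu).trans ?_
  refine mul_le_mul_of_nonneg_left ?_ (by positivity)
  let S : (H.edgeSet → G.Dart) → (H.edgeSet → G.Dart) → ℕ := fun φ φ' =>
    ∑ i, colorCount D (col i) (dartLabel φ) * colorCount D (col i) (dartLabel φ')
  have hle : ∀ a b, (if ∀ h, p h a b then ∑ i, (B i a * B i b : ℝ) else 0) ≤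
      ((if Consistent D (dartLabel a.2) ∧ Consistent D (dartLabel b.2) then S a.2 b.2 else 0 :
        ℕ) : ℝ)
      + (if SpecialPair (entryChar 𝒢 a.1) (entryChar 𝒢 b.1) then 1 else 0) *
        ((if D.IsMixed G (pairLabel (dartLabel a.2) (dartLabel b.2)) then S a.2 b.2 else 0 :
          ℕ) : ℝ) := by
    intro a b
    have hS : ∑ i, (B i a * B i b : ℝ) = (S a.2 b.2 : ℝ) := by
      simp only [S, B]
      push_cast
      rfl
    rw [hS]
    by_cases hp : ∀ h, p h a b
    · rcases consistent_or_isMixed hp with hc | hc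
      · rw [if_pos hp, if_pos hc]
        exact le_add_of_nonneg_right (by positivity)
      · rw [if_pos hp, if_pos hc.1, if_pos hc.2, one_mul]
        exact le_add_of_nonneg_left (by positivity)
    · rw [if_neg hp]
      positivity
  refine (Finset.sum_le_sum fun a _ => Finset.sum_le_sum fun b _ => hle a b).trans ?_
  simp only [Finset.sum_add_distrib]
  refine add_le_add ?_ ?_
  · have h1 : ∑ φ : H.edgeSet → G.Dart, ∑ φ' : H.edgeSet → G.Dart,
        (if Consistent D (dartLabel φ) ∧ Consistent D (dartLabel φ') then S φ φ' else 0) ≤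
        Nat.card I * G.labelledCopyCount H ^ 2 := by
      -- For a fixed coloring the consistent part factors into a square.
      calc _ = ∑ i, (∑ φ : H.edgeSet → G.Dart, if Consistent D (dartLabel φ) then
            colorCount D (col i) (dartLabel φ) else 0) ^ 2 := by
            simp only [sq, Finset.sum_mul_sum]
            rw [Finset.sum_comm (s := Finset.univ (α := I))]
            refine Finset.sum_congr rfl fun φ _ => ?_
            rw [Finset.sum_comm (s := Finset.univ (α := I))]
            refine Finset.sum_congr rfl fun φ' _ => ?_
            by_cases h1 : Consistent D (dartLabel φ) <;>
              by_cases h2 : Consistent D (dartLabel φ') <;> simp [h1, h2, S]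
        _ ≤ ∑ i : I, G.labelledCopyCount H ^ 2 :=
            Finset.sum_le_sum fun i _ =>
              Nat.pow_le_pow_left (sum_consistent_colorCount_le (D := D) (col i)) 2
        _ = _ := by
            rw [Finset.sum_const, smul_eq_mul, Finset.card_univ, Nat.card_eq_fintype_card]
    have h2 : ∑ a : Fin d × (H.edgeSet → G.Dart), ∑ b : Fin d × (H.edgeSet → G.Dart),
        (if Consistent D (dartLabel a.2) ∧ Consistent D (dartLabel b.2) then S a.2 b.2 else 0) ≤
        d * (d * (Nat.card I * G.labelledCopyCount H ^ 2)) := by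
      simp only [Fintype.sum_prod_type, Finset.sum_const, Finset.card_univ, Fintype.card_fin,
        smul_eq_mul, ← Finset.mul_sum]
      exact Nat.mul_le_mul_left _ (Nat.mul_le_mul_left _ h1)
    have h3 : (d : ℝ) ^ 2 * Nat.card I * (G.labelledCopyCount H : ℝ) ^ 2 =
        ((d * (d * (Nat.card I * G.labelledCopyCount H ^ 2)) : ℕ) : ℝ) := by
      push_cast; ring
    rw [h3]
    simp only [← Nat.cast_sum]
    exact Nat.cast_le.2 h2
  · have h1 := sum_isMixed_le (D := D) (G := G) col
    have h2 : (∑ j : Fin d, ∑ j' : Fin d,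
        if SpecialPair (entryChar 𝒢 j) (entryChar 𝒢 j') then (1 : ℝ) else 0) ≤ 2 * d := by
      rw [← Fintype.sum_prod_type', Finset.sum_boole]
      exact_mod_cast h𝒢.card_special_le
    have h3 : ∀ (f : Fin d → Fin d → ℝ) (g : (H.edgeSet → G.Dart) → (H.edgeSet → G.Dart) → ℝ),
        ∑ a : Fin d × (H.edgeSet → G.Dart), ∑ b : Fin d × (H.edgeSet → G.Dart),
          f a.1 b.1 * g a.2 b.2 = (∑ j, ∑ j', f j j') * ∑ φ, ∑ φ', g φ φ' := by
      intro f g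
      simp only [Fintype.sum_prod_type, Finset.sum_mul_sum]
    refine (h3 (fun j j' => if SpecialPair (entryChar 𝒢 j) (entryChar 𝒢 j') then (1 : ℝ) else 0)
      fun φ φ' => ((if D.IsMixed G (pairLabel (dartLabel φ) (dartLabel φ')) then S φ φ' else 0 :
        ℕ) : ℝ)).trans_le ?_
    refine mul_le_mul h2 ?_ (Finset.sum_nonneg fun _ _ => Finset.sum_nonneg fun _ _ =>
      Nat.cast_nonneg _) (by positivity)
    simp only [← Nat.cast_sum]
    exact Nat.cast_le.2 h1

end Moments

/-! ### Assembling the variance bound -/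

open Classical in
theorem norm_estimate_le {W V : Type*} [Fintype W] [DecidableEq W] {H : SimpleGraph W}
    [DecidableRel H.Adj] (D : Directing H) [Fintype V] [DecidableEq V] (G : SimpleGraph V)
    [DecidableRel G.Adj] {C d : ℕ} {𝒢 : Subgroup (Fin d → ℂˣ)} (hC : Fintype.card W ≤ C)
    (col : V → Fin C) (X : D.FreeHalfEdge → V → 𝒢) :
    ‖estimate D G col X‖ ≤ (Fintype.card W : ℝ) ^ Fintype.card W / d *
      ‖Matrix.trace (Matrix.diagonal (totalSum D G col X))‖ := by
  have hauto : (1 : ℝ) ≤ Nat.card (H ≃g H) := by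
    have : Finite (H ≃g H) := DFunLike.finite _
    have : Nonempty (H ≃g H) := ⟨SimpleGraph.Iso.refl⟩
    exact_mod_cast Nat.card_pos
  have hdf : (0 : ℝ) < C.descFactorial (Fintype.card W) := by
    exact_mod_cast Nat.descFactorial_pos.2 hC
  have h1 : (C : ℝ) ^ Fintype.card W / C.descFactorial (Fintype.card W) ≤
      (Fintype.card W : ℝ) ^ Fintype.card W := by
    rw [div_le_iff₀ hdf]
    exact_mod_cast pow_le_pow_mul_descFactorial hC
  unfold estimate
  set T := Matrix.trace (Matrix.diagonal (totalSum D G col X))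
  rw [norm_mul, norm_div, norm_div, norm_mul, norm_pow, Complex.norm_natCast, Complex.norm_natCast,
    Complex.norm_natCast, Complex.norm_natCast]
  have h2 : ‖T‖ / ((d : ℝ) * Nat.card (H ≃g H)) ≤ ‖T‖ / d := by
    rw [← div_div]
    exact div_le_self (by positivity) hauto
  calc _ ≤ (Fintype.card W : ℝ) ^ Fintype.card W * (‖T‖ / d) := by gcongr
    _ = _ := by ring

theorem mul_maxDegree_sq_le {m Δ C α : ℝ} (hm : 0 < m) (hΔ0 : 0 ≤ Δ) (hΔ : Δ ≤ m ^ (1 / 2 - α))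
    (hC : C ≤ m ^ (2 * α)) : C * Δ ^ 2 ≤ m := by
  calc C * Δ ^ 2 ≤ m ^ (2 * α) * (m ^ (1 / 2 - α)) ^ 2 := by gcongr
    _ = m := by
      rw [← Real.rpow_natCast, ← Real.rpow_mul hm.le, ← Real.rpow_add hm]
      norm_num
      ring_nf
      exact Real.rpow_one m

open Classical in
theorem estimateVariance_le {W : Type*} [Fintype W] [DecidableEq W] {H : SimpleGraph W}
    [DecidableRel H.Adj] (hconn : H.Connected) (hleaf : ∀ b, H.degree b ≠ 1) (D : Directing H)
    {V : Type*} [Fintype V] [DecidableEq V] (G : SimpleGraph V) [DecidableRel G.Adj] {C d : ℕ}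
    {𝒢 : Subgroup (Fin d → ℂˣ)} (h𝒢 : IsHashGroup d 𝒢) (hC0 : 0 < C) (hC : Fintype.card W ≤ C)
    (hCΔ : C * G.maxDegree ^ 2 ≤ Fintype.card G.Dart) (hCm : C ^ 3 ≤ Fintype.card G.Dart)
    {I J : Type*} [Fintype I] [Nonempty I] [Fintype J] [Nonempty J]
    {col : I → V → Fin C} {x : J → V → 𝒢}
    (hcol : KWiseIndependent (4 * Nat.card H.edgeSet) col)
    (hx : KWiseIndependent (4 * Nat.card H.edgeSet) x) :
    estimateVariance D G col x ≤ ((Fintype.card W : ℝ) ^ Fintype.card W) ^ 2 *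
      ((G.labelledCopyCount H : ℝ) ^ 2 + 2 * Nat.card (Setoid (Bool × HalfEdge H)) *
        ((Fintype.card G.Dart : ℝ) ^ Nat.card H.edgeSet /
          (d * (C : ℝ) ^ (2 * Nat.card H.edgeSet - Fintype.card W)))) := by
  obtain ⟨b⟩ := hconn.nonempty
  -- The distinguished half-edge at any vertex provides an edge; hence the independence covers at
  -- least four points.
  have hk : 0 < Nat.card H.edgeSet := Nat.card_pos_iff.2 ⟨⟨(D.dist b).1⟩, inferInstance⟩
  have hm : 0 < Fintype.card G.Dart := lt_of_lt_of_le (by positivity) hCm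
  obtain ⟨a⟩ := Fintype.card_pos_iff.1 hm
  have : Nonempty V := ⟨a.fst⟩
  have : Finite 𝒢 := hx.finite (by omega)
  have hd : (0 : ℝ) < d := by exact_mod_cast h𝒢.pos
  have hI : (0 : ℝ) < Nat.card I := by exact_mod_cast Nat.card_pos
  have hJ : (0 : ℝ) < Nat.card J := by exact_mod_cast Nat.card_pos
  have hCp : (0 : ℝ) < C := by exact_mod_cast hC0
  set t := Fintype.card W
  set k := Nat.card H.edgeSet
  set M : ℕ := ∑ π : Bool → HalfEdge H → V with D.IsMixed G π,
    Nat.card {i // D.Monochromatic π (col i)} with hM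
  have hmixed : (M : ℝ) * (C : ℝ) ^ (2 * k - t) ≤ Nat.card (Setoid (Bool × HalfEdge H)) *
      ((Fintype.card G.Dart : ℝ) ^ k * Nat.card I) := by
    exact_mod_cast Directing.sum_mixed_le hconn hleaf hC0 hCΔ hCm hcol _
      fun π hπ => (Finset.mem_filter.1 hπ).2
  have hsum := sum_norm_trace_sq_le (D := D) (G := G) h𝒢 col hx (by omega)
  rw [← hM] at hsum
  refine (complexVariance_le _).trans ?_
  have hcard : (Fintype.card (I × (D.FreeHalfEdge → J)) : ℝ) =
      Nat.card I * (Nat.card J : ℝ) ^ Fintype.card D.FreeHalfEdge := by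
    rw [Fintype.card_prod, Fintype.card_fun, Nat.card_eq_fintype_card, Nat.card_eq_fintype_card]
    push_cast
    rfl
  rw [hcard, div_le_iff₀ (by positivity)]
  calc _ ≤ ∑ ω : I × (D.FreeHalfEdge → J), ((t : ℝ) ^ t / d) ^ 2 *
        ‖Matrix.trace (Matrix.diagonal (totalSum D G (col ω.1) fun h => x (ω.2 h)))‖ ^ 2 := by
        refine Finset.sum_le_sum fun ω _ => ?_
        rw [← mul_pow]
        exact pow_le_pow_left₀ (norm_nonneg _) (norm_estimate_le D G hC _ _) 2
    _ ≤ ((t : ℝ) ^ t / d) ^ 2 * ((Nat.card J : ℝ) ^ Fintype.card D.FreeHalfEdge *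
      ((d : ℝ) ^ 2 * Nat.card I * (G.labelledCopyCount H : ℝ) ^ 2 + 2 * d * M)) := by
        rw [← Finset.mul_sum]
        exact mul_le_mul_of_nonneg_left hsum (by positivity)
    _ = ((t : ℝ) ^ t) ^ 2 * (Nat.card J : ℝ) ^ Fintype.card D.FreeHalfEdge *
      (Nat.card I * (G.labelledCopyCount H : ℝ) ^ 2 + 2 / d * M) := by
        field_simp
    _ ≤ ((t : ℝ) ^ t) ^ 2 * (Nat.card J : ℝ) ^ Fintype.card D.FreeHalfEdge *
      (Nat.card I * (G.labelledCopyCount H : ℝ) ^ 2 + 2 / d *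
        (Nat.card (Setoid (Bool × HalfEdge H)) *
          ((Fintype.card G.Dart : ℝ) ^ k * Nat.card I) / (C : ℝ) ^ (2 * k - t))) := by
        gcongr
        rwa [le_div_iff₀ (by positivity)]
    _ = _ := by
        field_simp

end SubgraphCount

theorem mainTheorem1 {W : Type*} [Fintype W] [DecidableEq W] (H : SimpleGraph W)
    [DecidableRel H.Adj] (hconn : H.Connected) (hleaf : ∀ b, H.degree b ≠ 1) :
    ∃ K : ℝ, ∀ (D : SubgraphCount.Directing H)
      (V : Type*) [Fintype V] [DecidableEq V] (G : SimpleGraph V) [DecidableRel G.Adj]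
      (α : ℝ) (C d : ℕ) (𝒢 : Subgroup (Fin d → ℂˣ))
      (I J : Type*) [Fintype I] [Nonempty I] [Fintype J] [Nonempty J]
      (col : I → V → Fin C) (x : J → V → 𝒢),
      SubgraphCount.IsHashGroup d 𝒢 →
      SubgraphCount.KWiseIndependent (4 * H.edgeFinset.card) col →
      SubgraphCount.KWiseIndependent (4 * H.edgeFinset.card) x →
      0 < α →
      (G.maxDegree : ℝ) ≤ (Fintype.card G.Dart : ℝ) ^ (1 / 2 - α) →
      (C : ℝ) ≤ min ((Fintype.card G.Dart : ℝ) ^ (2 * α))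
        ((Fintype.card G.Dart : ℝ) ^ (1 / 3 : ℝ)) →
      Fintype.card W ≤ C →
      SubgraphCount.estimateVariance D G col x ≤
        K * ((G.copyCount H : ℝ) ^ 2 +
          (Fintype.card G.Dart : ℝ) ^ H.edgeFinset.card /
            ((d : ℝ) * (C : ℝ) ^ (2 * H.edgeFinset.card - Fintype.card W))) := by
  set t := Fintype.card W with ht
  set K₀ : ℝ := ((Nat.card (Setoid (Bool × SubgraphCount.HalfEdge H)) : ℕ) : ℝ) with hK₀
  -- The outer factor bounds the squared normalization, the inner power passes from labelled copies
  -- to subgraphs, `K₀` counts the coincidence patterns, and the `2` accounts for equal and inverse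
  -- characters.
  refine ⟨((t : ℝ) ^ t) ^ 2 * (((t : ℝ) ^ t) ^ 2 + 2 * K₀), ?_⟩
  intro D V _ _ G _ α C d 𝒢 I J _ _ _ _ col x h𝒢 hcol hx hα hΔ hCle hC
  have hk : H.edgeFinset.card = Nat.card H.edgeSet := by
    rw [SimpleGraph.edgeFinset_card, Nat.card_eq_fintype_card]
  rw [hk] at hcol hx ⊢
  have := hconn.nonempty
  have hC0 : 0 < C := Fintype.card_pos.trans_le hC
  obtain ⟨hC1, hC2⟩ := le_min_iff.1 hCle
  set m := Fintype.card G.Dart with hm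
  have hm0 : (0 : ℝ) < m := by
    -- Without edges in `G`, the bound `C ≤ 0 ^ (2 * α) = 0` would fail.
    rcases Nat.eq_zero_or_pos m with h0 | h0
    · rw [h0, Nat.cast_zero, Real.zero_rpow (by positivity)] at hC1
      exact absurd hC1 (not_le.2 (by exact_mod_cast hC0))
    · exact_mod_cast h0
  have hCΔ : C * G.maxDegree ^ 2 ≤ m := by
    exact_mod_cast SubgraphCount.mul_maxDegree_sq_le hm0 (Nat.cast_nonneg _) hΔ hC1
  have hCm : C ^ 3 ≤ m := by
    have h1 : (C : ℝ) ^ 3 ≤ ((m : ℝ) ^ (1 / 3 : ℝ)) ^ 3 := by gcongr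
    rw [← Real.rpow_natCast, ← Real.rpow_natCast, ← Real.rpow_mul hm0.le] at h1
    norm_num at h1
    exact_mod_cast h1
  refine (SubgraphCount.estimateVariance_le hconn hleaf D G h𝒢 hC0 hC hCΔ hCm hcol hx).trans ?_
  have hcopy : (G.labelledCopyCount H : ℝ) ≤ (t : ℝ) ^ t * G.copyCount H := by
    exact_mod_cast SubgraphCount.labelledCopyCount_le G H
  rw [← hK₀, mul_assoc (((t : ℝ) ^ t) ^ 2) (((t : ℝ) ^ t) ^ 2 + 2 * K₀)]
  refine mul_le_mul_of_nonneg_left ?_ (by positivity)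
  set R : ℝ := (m : ℝ) ^ Nat.card H.edgeSet / (d * (C : ℝ) ^ (2 * Nat.card H.edgeSet - t))
  have hR : 0 ≤ R := by positivity
  have hK : 0 ≤ K₀ := Nat.cast_nonneg _
  calc (G.labelledCopyCount H : ℝ) ^ 2 + 2 * K₀ * R ≤ ((t : ℝ) ^ t * G.copyCount H) ^ 2 +
        2 * K₀ * R := by gcongr
    _ ≤ ((t : ℝ) ^ t * G.copyCount H) ^ 2 + 2 * K₀ * R +
        (2 * K₀ * (G.copyCount H : ℝ) ^ 2 + ((t : ℝ) ^ t) ^ 2 * R) :=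
        le_add_of_nonneg_right (by positivity)
    _ = _ := by ring
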